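/- Let $n\in\mathbb{N}$, let $u$ be a (real- or complex-valued) harmonic function on $\mathbb{R}^n$, and let $x\in\mathbb{R}^n$ be such that the series $$\sum_{|\beta|=0}^{\infty}\frac{\partial^\beta u(x)}{\sqrt{\beta!}}\,y^\beta$$ over all multi-indices $\beta\in\mathbb{N}_0^n$ converges absolutely for every $y\in\mathbb{R}^n$. Then $u$ has a unique analytic extension $\tilde u$ onto $\mathbb{C}^n$. Let $h,\mathcal D>0$ with $\sqrt{\mathcal D}\,h<1$. Then the series defining the quasi-interpolant $$Mu(x)=(\pi\mathcal D)^{-n/2}\sum_{m\in\mathbb{Z}^n}u(hm)\,e^{-|x-hm|^2/(h^2\mathcal D)}$$ converges absolutely, and $$Mu(x)-u(x)=\lim_{M\to\infty}\mathcal E_{h,2M}(x)=\sum_{m\in\mathbb{Z}^n\setminus\{0\}}\tilde u(x+\pi i h\mathcal D m)\,e^{-\pi^2\mathcal D|m|^2}\,e^{2\pi i\langle m,x\rangle/h},$$ where the last series converges absolutely. Here $$\mathcal E_{h,2M}(x)=u(x)\Big((\pi\mathcal D)^{-n/2}\sum_{m\in\mathbb{Z}^n}e^{-|x-hm|^2/(h^2\mathcal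 D)}-1\Big) +(\pi\mathcal D)^{-n/2}\sum_{|\beta|=1}^{2M-1}(-h\sqrt{\mathcal D})^{|\beta|}\,\partial^\beta u(x)\sum_{m\in\mathbb{Z}^n}e^{-|x-hm|^2/(h^2\mathcal D)}\sum_{\alpha\le\beta}\frac{a_{\beta-\alpha}}{\alpha!}\Big(\frac{x-hm}{h\sqrt{\mathcal D}}\Big)^{\alpha},$$ with $a_\gamma=0$ if $\gamma$ has an odd component and $a_{2\gamma}=\dfrac{(-1)^{|\gamma|}}{\gamma!\,4^{|\gamma|}}$. -/

import Mathlib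

noncomputable section

namespace QuasiInterp

open Finset

/-- Partial derivative of `u` in the `j`-th coordinate direction. -/
def partialDeriv {n : ℕ} (j : Fin n) (u : EuclideanSpace ℝ (Fin n) → ℂ) :
    EuclideanSpace ℝ (Fin n) → ℂ :=
  fun x => lineDeriv ℝ u x (EuclideanSpace.single j 1)

/-- The partial derivative `∂^β u = ∂_1^{β_1} ⋯ ∂_n^{β_n} u` for a multi-index `β`. -/
def multiDeriv {n : ℕ} (β : Fin n → ℕ) (u : EuclideanSpace ℝ (Fin n) → ℂ) :
    EuclideanSpace ℝ (Fin n) → ℂ :=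
  (List.finRange n).foldr (fun j g => (partialDeriv j)^[β j] g) u

/-- The multi-index factorial `β! = ∏_j β_j!`. -/
def multiFactorial {n : ℕ} (β : Fin n → ℕ) : ℕ := ∏ j, (β j).factorial

/-- The order `|β| = ∑_j β_j` of a multi-index. -/
def multiOrder {n : ℕ} (β : Fin n → ℕ) : ℕ := ∑ j, β j

/-- The monomial `y^β = ∏_j y_j^{β_j}`. -/
def monomial {n : ℕ} (y : Fin n → ℝ) (β : Fin n → ℕ) : ℝ := ∏ j, y j ^ β j

/-- The grid point `h m` of `ℝ^n`, for `m ∈ ℤ^n`. -/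
def gridPoint {n : ℕ} (h : ℝ) (m : Fin n → ℤ) : EuclideanSpace ℝ (Fin n) :=
  WithLp.toLp 2 (fun j => h * (m j : ℝ))

/-- The Gaussian weight `exp(-|x - h m|² / (h² D))`. -/
def gaussianWeight {n : ℕ} (h D : ℝ) (x : EuclideanSpace ℝ (Fin n)) (m : Fin n → ℤ) : ℝ :=
  Real.exp (-‖x - gridPoint h m‖ ^ 2 / (h ^ 2 * D))

/-- The quasi-interpolant `M u(x) = (π D)^{-n/2} ∑_{m ∈ ℤ^n} u(h m) exp(-|x - h m|² / (h² D))`. -/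
def quasiInterpolant {n : ℕ} (h D : ℝ) (u : EuclideanSpace ℝ (Fin n) → ℂ)
    (x : EuclideanSpace ℝ (Fin n)) : ℂ :=
  (((Real.pi * D) ^ (-(n : ℝ) / 2) : ℝ) : ℂ) *
    ∑' m : Fin n → ℤ, u (gridPoint h m) * (gaussianWeight h D x m : ℂ)

/-- The coefficients `a_γ`: zero if `γ` has an odd component, and
`a_{2δ} = (-1)^{|δ|} / (δ! 4^{|δ|})`. -/
def coeffA {n : ℕ} (γ : Fin n → ℕ) : ℝ :=
  if ∀ j, Even (γ j) then
    (-1) ^ multiOrder (fun j => γ j / 2) /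
      (multiFactorial (fun j => γ j / 2) * 4 ^ multiOrder (fun j => γ j / 2))
  else 0

/-- The saturation error of order `N`,
`u(x) ((π D)^{-n/2} ∑_m exp(-|x - h m|²/(h² D)) - 1)
+ (π D)^{-n/2} ∑_{|β|=1}^{N-1} (-h √D)^{|β|} ∂^β u(x)
  ∑_m exp(-|x - h m|²/(h² D)) ∑_{α ≤ β} (a_{β-α} / α!) ((x - h m)/(h √D))^α`. -/
def saturationError {n : ℕ} (h D : ℝ) (u : EuclideanSpace ℝ (Fin n) → ℂ) (N : ℕ)
    (x : EuclideanSpace ℝ (Fin n)) : ℂ :=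
  u x * (((Real.pi * D) ^ (-(n : ℝ) / 2) * (∑' m : Fin n → ℤ, gaussianWeight h D x m) - 1 : ℝ) : ℂ)
  + (((Real.pi * D) ^ (-(n : ℝ) / 2) : ℝ) : ℂ) *
    ∑ k ∈ Finset.Ico 1 N, ∑ β ∈ Finset.piAntidiag (Finset.univ : Finset (Fin n)) k,
      (((-(h * √D)) ^ multiOrder β : ℝ) : ℂ) * multiDeriv β u x *
        ((∑' m : Fin n → ℤ, gaussianWeight h D x m *
          ∑ α ∈ Finset.Iic β, coeffA (β - α) / (multiFactorial α : ℝ) *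
            monomial (fun j => (x j - h * (m j : ℝ)) / (h * √D)) α : ℝ) : ℂ)

/-- `v` is an analytic extension of `u : ℝ^n → ℂ` onto `ℂ^n`. -/
def IsAnalyticExtension {n : ℕ} (u : EuclideanSpace ℝ (Fin n) → ℂ) (v : (Fin n → ℂ) → ℂ) : Prop :=
  AnalyticOnNhd ℂ v Set.univ ∧ ∀ x : EuclideanSpace ℝ (Fin n), v (fun j => (x j : ℂ)) = u x

end QuasiInterp

end

/-!
Write `d β = ∂^β u(x)` and `κ = h² D / 4`.

*The extension.* A harmonic function on `ℝ^n` is real analytic along lines. Integrating by parts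
against a radial bump function shows that the radial averages of `u` do not depend on the radius
(`integral_radialBump_smul`). This mean value property gives smoothness, an interior gradient
estimate (`norm_dirDeriv_le`), and by iteration on balls of radius `1 / k` the convergence of the
Taylor series (`hasSum_taylor_of_harmonic`). The hypothesis on the numbers `d β` makes the Taylor
series at `x` converge on all of `ℂ^n`; on real points its sum is `u` by the identity theorem on
lines (`eq_multiSeries_of_harmonic`), and a second use of the identity theorem gives uniqueness
(`eq_of_eq_on_real`).

*The two lattice measures.* The quasi-interpolant integrates `u` against a Gaussian measure on the
grid, a product of one-dimensional measures with nodes `h m - x_j`. The dual series integrates the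
extension against a product of measures with nodes `π i h D m`. Both have Gaussian decay
`exp (-|q|² / (h² D))` in their nodes `q`, and the extension grows more slowly than every Gaussian
`exp (ε |z|²)` (`norm_mul_prod_le`), so the double series over multi-indices and lattice points
converge absolutely, and the integrals pair `d` with the moments of the two measures
(`hasSum_multiSeries_moment`).

By Poisson summation the Laplace transforms of the one-dimensional measures differ by the factor
`exp (κ s²)` (`tsum_grid_eq_tsum_dual`), so the grid moments are the dual moments convolved with the
Taylor coefficients of `exp (κ s²)`, and vice versa with `-κ`. In `n` variables the convolution
transposes to the operator `exp (κ Δ)` acting on `u`, which fixes harmonic functions; hence in each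
degree the pairings of `d` with the two families of moments agree (`sum_mul_convolution_gaussCoeff`).
Conversely the lattice sums in the saturation error, built from Hermite polynomials, are the dual
moments (`saturation_bracket`). So the quasi-interpolant is the sum of the degree-wise pairings with
the dual moments, the saturation error is a partial sum of the same series minus `u x`, and
regrouping by lattice points gives the dual series, in which the term `m = 0` is `u x`.
-/

namespace QuasiInterp

open MeasureTheory Set Filter Topology InnerProductSpace
open scoped ContDiff

/-! ### The mean value property of harmonic functions -/

section Harmonic

variable {F : Type*} [NormedAddCommGroup F] [NormedSpace ℝ F]

/-- The profile of the radial bump function: smooth, positive on `(-∞, 1)`, zero on `[1, ∞)`. -/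
noncomputable def profile (r : ℝ) : ℝ := Real.smoothTransition (1 - r)

/-- The antiderivative of `profile` that vanishes on `[1, ∞)`. -/
noncomputable def profileInt (r : ℝ) : ℝ := ∫ t in (1 : ℝ)..r, profile t

variable {E : Type*} [NormedAddCommGroup E]

/-- The radial bump function `z ↦ profile (‖z‖ ^ 2)`, supported in the closed unit ball. -/
noncomputable def radialBump (z : E) : ℝ := profile (‖z‖ ^ 2)

theorem contDiff_profile : ContDiff ℝ ∞ profile :=
  Real.smoothTransition.contDiff.comp (contDiff_const.sub contDiff_id)

theorem profile_eq_zero {r : ℝ} (hr : 1 ≤ r) : profile r = 0 :=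
  Real.smoothTransition.zero_of_nonpos (by linarith)

theorem hasDerivAt_profileInt (r : ℝ) : HasDerivAt profileInt (profile r) r :=
  intervalIntegral.integral_hasDerivAt_right
    (contDiff_profile.continuous.intervalIntegrable _ _)
    (contDiff_profile.continuous.stronglyMeasurableAtFilter _ _)
    contDiff_profile.continuous.continuousAt

theorem profileInt_eq_zero {r : ℝ} (hr : 1 ≤ r) : profileInt r = 0 := by
  rw [profileInt, intervalIntegral.integral_congr (g := fun _ => 0)]
  · simp
  · intro t ht
    rw [uIcc_of_le hr] at ht
    exact profile_eq_zero ht.1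

theorem radialBump_eq_zero {z : E} (hz : z ∉ Metric.closedBall (0 : E) 1) : radialBump z = 0 := by
  apply profile_eq_zero
  simp only [Metric.mem_closedBall, dist_zero_right, not_le] at hz
  nlinarith

theorem radialBump_nonneg (z : E) : 0 ≤ radialBump z := Real.smoothTransition.nonneg _

variable [InnerProductSpace ℝ E]

/-- The directional derivative of `f` along the fixed vector `w`, as an operator on functions. -/
noncomputable def dirDeriv (w : E) (f : E → F) : E → F := fun y => fderiv ℝ f y w

theorem contDiff_radialBump : ContDiff ℝ ∞ (radialBump : E → ℝ) :=
  contDiff_profile.comp (contDiff_norm_sq ℝ)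

theorem hasFDerivAt_profileInt_norm_sq (z : E) :
    HasFDerivAt (fun z : E => profileInt (‖z‖ ^ 2)) (profile (‖z‖ ^ 2) • (2 • innerSL ℝ z)) z :=
  (hasDerivAt_profileInt _).comp_hasFDerivAt z (hasStrictFDerivAt_norm_sq z).hasFDerivAt

theorem dirDeriv_dirDeriv {u : E → F} {y : E} (hu : ContDiffAt ℝ 2 u y) (v w : E) :
    dirDeriv w (dirDeriv v u) y = fderiv ℝ (fderiv ℝ u) y w v := by
  have h1 : DifferentiableAt ℝ (fderiv ℝ u) y :=
    (hu.fderiv_right (m := 1) (by norm_num)).differentiableAt (by norm_num)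
  unfold dirDeriv
  rw [fderiv_clm_apply h1 (by fun_prop)]
  simp

variable [FiniteDimensional ℝ E]

theorem hasCompactSupport_radialBump : HasCompactSupport (radialBump : E → ℝ) :=
  HasCompactSupport.intro (isCompact_closedBall 0 1) fun _ => radialBump_eq_zero

theorem hasCompactSupport_profileInt_norm_sq :
    HasCompactSupport (fun z : E => profileInt (‖z‖ ^ 2)) := by
  refine HasCompactSupport.intro (isCompact_closedBall 0 1) fun z hz => profileInt_eq_zero ?_
  simp only [Metric.mem_closedBall, dist_zero_right, not_le] at hz
  nlinarith

theorem laplacian_eq_sum_dirDeriv {u : E → F} {y : E} (hu : ContDiffAt ℝ 2 u y)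
    {ι : Type*} [Fintype ι] (b : OrthonormalBasis ι ℝ E) :
    Laplacian.laplacian u y = ∑ i, dirDeriv (b i) (dirDeriv (b i) u) y := by
  simp [laplacian_eq_iteratedFDeriv_orthonormalBasis u b, iteratedFDeriv_two_apply,
    dirDeriv_dirDeriv hu]

variable [MeasurableSpace E] [BorelSpace E]

theorem integral_radialBump_pos : 0 < ∫ z : E, radialBump z := by
  have hc := (contDiff_radialBump (E := E)).continuous
  refine hc.integral_pos_of_hasCompactSupport_nonneg_nonzero hasCompactSupport_radialBump
    radialBump_nonneg (x := 0) ?_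
  simp [radialBump, profile]

/-- The derivative of the radial averages vanishes: `profile (‖z‖ ^ 2) • z` is half the gradient of
a compactly supported function, so integration by parts produces the Laplacian of `u`. -/
theorem integral_radialBump_smul_fderiv [CompleteSpace F] {u : E → F} (hu : HarmonicOnNhd u univ)
    (y : E) (s : ℝ) : ∫ z : E, radialBump z • fderiv ℝ u (y + s • z) z = 0 := by
  have hu2 : ContDiff ℝ 2 u := contDiff_iff_contDiffAt.2 fun z => (hu z (mem_univ z)).1
  let b := stdOrthonormalBasis ℝ E
  have hg : ∀ i, ContDiff ℝ 1 (dirDeriv (b i) u) := fun i =>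
    (hu2.fderiv_right (m := 1) (by norm_num)).clm_apply contDiff_const
  have hgd : ∀ i z, fderiv ℝ (fun z => dirDeriv (b i) u (y + s • z)) z (b i)
      = s • dirDeriv (b i) (dirDeriv (b i) u) (y + s • z) := by
    intro i z
    have h1 : HasFDerivAt (fun z : E => y + s • z) (s • ContinuousLinearMap.id ℝ E) z :=
      ((hasFDerivAt_id z).const_smul s).const_add y
    have h2 := (((hg i).differentiable (by norm_num)) (y + s • z)).hasFDerivAt.comp z h1
    have h3 := h2.fderiv
    simp only [Function.comp_def] at h3
    rw [h3]
    simp [dirDeriv]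
  have hgc : ∀ i, ContDiff ℝ 1 (fun z => dirDeriv (b i) u (y + s • z)) := fun i =>
    (hg i).comp (by fun_prop)
  let Ψ : E → ℝ := fun z => profileInt (‖z‖ ^ 2)
  have hΨd : ∀ z, fderiv ℝ Ψ z = profile (‖z‖ ^ 2) • (2 • innerSL ℝ z) := fun z =>
    (hasFDerivAt_profileInt_norm_sq z).fderiv
  have hΨc : Continuous Ψ := continuous_iff_continuousAt.2 fun z =>
    (hasFDerivAt_profileInt_norm_sq z).continuousAt
  have hΨ : HasCompactSupport Ψ := hasCompactSupport_profileInt_norm_sq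
  have hbc := (contDiff_radialBump (E := E)).continuous
  have hΨb : ∀ z i, fderiv ℝ Ψ z (b i) = radialBump z * (2 * inner ℝ z (b i)) := by
    intro z i
    simp [hΨd, radialBump]
  have hi1 : ∀ i, Integrable
      (fun z => fderiv ℝ Ψ z (b i) • dirDeriv (b i) u (y + s • z)) := by
    intro i
    simp only [hΨb]
    apply Continuous.integrable_of_hasCompactSupport
    · have := (hgc i).continuous
      fun_prop
    · exact (hasCompactSupport_radialBump.mul_right).smul_right
  have hparts : ∀ i, ∫ z : E, fderiv ℝ Ψ z (b i) • dirDeriv (b i) u (y + s • z)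
      = - ∫ z : E, Ψ z • (s • dirDeriv (b i) (dirDeriv (b i) u) (y + s • z)) := by
    intro i
    have := integral_smul_fderiv_eq_neg_fderiv_smul_of_integrable (μ := volume) (f := Ψ)
      (g := fun z => dirDeriv (b i) u (y + s • z)) (v := b i) (hi1 i) ?_ ?_ ?_ ?_
    · rw [eq_neg_iff_add_eq_zero, add_comm, ← eq_neg_iff_add_eq_zero, ← this]
      simp only [hgd]
    · apply Continuous.integrable_of_hasCompactSupport
      · exact hΨc.smul (((hgc i).continuous_fderiv (by norm_num)).clm_apply continuous_const)
      · exact hΨ.smul_right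
    · exact Continuous.integrable_of_hasCompactSupport (hΨc.smul (hgc i).continuous) hΨ.smul_right
    · exact fun z _ => (hasFDerivAt_profileInt_norm_sq z).differentiableAt
    · exact fun z _ => (hgc i).differentiable (by norm_num) z
  have hexp : ∀ z, radialBump z • fderiv ℝ u (y + s • z) z
      = (1 / 2 : ℝ) • ∑ i, fderiv ℝ Ψ z (b i) • dirDeriv (b i) u (y + s • z) := by
    intro z
    have hL : ∀ A : E →L[ℝ] F, A z = ∑ i, inner ℝ (b i) z • A (b i) := by
      intro A
      conv_lhs => rw [← b.sum_repr' z]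
      simp
    rw [hL]
    simp only [hΨb, Finset.smul_sum, smul_smul, dirDeriv]
    refine Finset.sum_congr rfl fun i _ => ?_
    rw [real_inner_comm]
    congr 1
    ring
  simp only [hexp]
  rw [integral_smul, integral_finsetSum _ fun i _ => hi1 i]
  simp only [hparts]
  rw [Finset.sum_neg_distrib, ← integral_finsetSum]
  · have : ∀ z, ∑ i, Ψ z • (s • dirDeriv (b i) (dirDeriv (b i) u) (y + s • z)) = 0 := by
      intro z
      rw [← Finset.smul_sum, ← Finset.smul_sum, ← laplacian_eq_sum_dirDeriv hu2.contDiffAt b,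
        (hu _ (mem_univ _)).2.self_of_nhds]
      simp
    simp [this]
  · intro i _
    apply Continuous.integrable_of_hasCompactSupport
    · have h1 : Continuous (fun z => dirDeriv (b i) (dirDeriv (b i) u) z) :=
        ((hg i).continuous_fderiv (by norm_num)).clm_apply continuous_const
      have : Continuous fun z : E => y + s • z := by fun_prop
      exact hΨc.smul ((h1.comp this).const_smul s)
    · exact hΨ.smul_right

theorem hasDerivAt_integral_radialBump [CompleteSpace F] {u : E → F} (hu : ContDiff ℝ 1 u)
    (y : E) (s : ℝ) :
    HasDerivAt (fun s : ℝ => ∫ z : E, radialBump z • u (y + s • z))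
      (∫ z : E, radialBump z • fderiv ℝ u (y + s • z) z) s := by
  have hbc := (contDiff_radialBump (E := E)).continuous
  have huc := hu.continuous
  have hu' : Continuous fun p : ℝ × E => fderiv ℝ u (y + p.1 • p.2) p.2 := by
    have h1 := hu.continuous_fderiv (by norm_num)
    exact (h1.comp (by fun_prop)).clm_apply (by fun_prop)
  obtain ⟨C, hC⟩ := ((isCompact_closedBall s 1).prod
    (isCompact_closedBall (0 : E) 1)).exists_bound_of_continuousOn hu'.continuousOn
  refine (hasDerivAt_integral_of_dominated_loc_of_deriv_le (μ := volume)
    (F := fun (s : ℝ) (z : E) => radialBump z • u (y + s • z))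
    (F' := fun (s : ℝ) (z : E) => radialBump z • fderiv ℝ u (y + s • z) z)
    (bound := fun z => radialBump z * C)
    (Metric.ball_mem_nhds s one_pos) ?_ ?_ ?_ ?_ ?_ ?_).2
  · exact Eventually.of_forall fun t => (by fun_prop : Continuous _).aestronglyMeasurable
  · exact Continuous.integrable_of_hasCompactSupport (by fun_prop)
      hasCompactSupport_radialBump.smul_right
  · exact (hbc.smul (hu'.comp (by fun_prop : Continuous fun z : E => (s, z)))).aestronglyMeasurable
  · refine Eventually.of_forall fun z t ht => ?_
    rw [norm_smul, Real.norm_of_nonneg (radialBump_nonneg z)]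
    by_cases hz : z ∈ Metric.closedBall (0 : E) 1
    · exact mul_le_mul_of_nonneg_left (hC (t, z) ⟨Metric.ball_subset_closedBall ht, hz⟩)
        (radialBump_nonneg z)
    · simp [radialBump_eq_zero hz]
  · exact Continuous.integrable_of_hasCompactSupport (by fun_prop)
      hasCompactSupport_radialBump.mul_right
  · refine Eventually.of_forall fun z t _ => ?_
    have h1 : HasDerivAt (fun t : ℝ => y + t • z) z t := by
      simpa using ((hasDerivAt_id t).smul_const z).const_add y
    exact ((hu.differentiable (by norm_num) _).hasFDerivAt.comp_hasDerivAt t h1).const_smul _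

/-- Mean value property: radial averages of a harmonic function reproduce its value at the
centre. -/
theorem integral_radialBump_smul [CompleteSpace F] {u : E → F} (hu : HarmonicOnNhd u univ)
    (y : E) (s : ℝ) :
    ∫ z : E, radialBump z • u (y + s • z) = (∫ z : E, radialBump z) • u y := by
  have hu2 : ContDiff ℝ 2 u := contDiff_iff_contDiffAt.2 fun z => (hu z (mem_univ z)).1
  have hd := hasDerivAt_integral_radialBump (hu2.of_le (by norm_num)) y
  have := is_const_of_deriv_eq_zero (fun s => (hd s).differentiableAt)
    (fun s => by rw [(hd s).deriv, integral_radialBump_smul_fderiv hu]) s 0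
  rw [this]
  simp [integral_smul_const]

theorem contDiff_of_harmonic [CompleteSpace F] {u : E → F} (hu : HarmonicOnNhd u univ) :
    ContDiff ℝ ∞ u := by
  have hu2 : ContDiff ℝ 2 u := contDiff_iff_contDiffAt.2 fun z => (hu z (mem_univ z)).1
  have h1 := hasCompactSupport_radialBump.contDiff_convolution_left (𝕜 := ℝ) (μ := volume)
    (ContinuousLinearMap.lsmul ℝ ℝ) (contDiff_radialBump (E := E))
    hu2.continuous.locallyIntegrable
  have hpos := integral_radialBump_pos (E := E)
  have h2 : u = fun y => (∫ z : E, radialBump z)⁻¹ •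
      convolution radialBump u (ContinuousLinearMap.lsmul ℝ ℝ) volume y := by
    ext y
    have := integral_radialBump_smul hu y (-1)
    simp only [neg_smul, one_smul, ← sub_eq_add_neg] at this
    rw [convolution_def]
    simp only [ContinuousLinearMap.lsmul_apply]
    rw [this, inv_smul_smul₀ hpos.ne']
  rw [h2]
  exact contDiff_const.smul h1

end Harmonic

/-! ### Gradient estimates and Taylor series of harmonic functions along lines -/

section Taylor

variable {F : Type*} [NormedAddCommGroup F] [NormedSpace ℝ F]
variable {E : Type*} [NormedAddCommGroup E] [InnerProductSpace ℝ E]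

/-- The one-variable power series `∑ z ^ k • a k`, as a formal multilinear series. -/
noncomputable def powerSeriesOfCoeff (a : ℕ → F) : FormalMultilinearSeries ℝ ℝ F :=
  fun k => ContinuousMultilinearMap.mkPiRing ℝ (Fin k) (a k)

theorem coeff_powerSeriesOfCoeff (a : ℕ → F) (k : ℕ) : (powerSeriesOfCoeff a).coeff k = a k := by
  simp [FormalMultilinearSeries.coeff, powerSeriesOfCoeff]

theorem contDiff_dirDeriv {u : E → F} (hu : ContDiff ℝ ∞ u) (w : E) :
    ContDiff ℝ ∞ (dirDeriv w u) :=
  (hu.fderiv_right (m := ∞) (by simp)).clm_apply contDiff_const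

theorem contDiff_iterate_dirDeriv {u : E → F} (hu : ContDiff ℝ ∞ u) (w : E) (k : ℕ) :
    ContDiff ℝ ∞ ((dirDeriv w)^[k] u) := by
  induction k with
  | zero => simpa
  | succ k ih => rw [Function.iterate_succ_apply']; exact contDiff_dirDeriv ih w

theorem dirDeriv_comm {u : E → F} (hu : ContDiff ℝ ∞ u) (v w : E) :
    dirDeriv v (dirDeriv w u) = dirDeriv w (dirDeriv v u) := by
  ext y
  have h2 : ContDiffAt ℝ 2 u y :=
    (hu.of_le (mod_cast le_top : ((2 : ℕ∞) : WithTop ℕ∞) ≤ ∞)).contDiffAt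
  rw [dirDeriv_dirDeriv h2, dirDeriv_dirDeriv h2]
  exact (h2.isSymmSndFDerivAt (by simp)).eq v w

theorem dirDeriv_smul_left (c : ℝ) (w : E) (u : E → F) :
    dirDeriv (c • w) u = c • dirDeriv w u := by
  ext y
  simp [dirDeriv]

theorem dirDeriv_const_smul (c : ℝ) (w : E) {u : E → F} (hu : ContDiff ℝ ∞ u) :
    dirDeriv w (c • u) = c • dirDeriv w u := by
  ext y
  have := (hu.differentiable (by simp)) y
  simp [dirDeriv, fderiv_const_smul this]

theorem iterate_dirDeriv_smul_left (c : ℝ) (w : E) {u : E → F} (hu : ContDiff ℝ ∞ u) (k : ℕ) :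
    (dirDeriv (c • w))^[k] u = c ^ k • (dirDeriv w)^[k] u := by
  induction k with
  | zero => simp
  | succ k ih =>
    rw [Function.iterate_succ_apply', ih, dirDeriv_smul_left,
      dirDeriv_const_smul _ _ (contDiff_iterate_dirDeriv hu w k), Function.iterate_succ_apply',
      smul_smul, pow_succ']

theorem dirDeriv_fun_sum {ι : Type*} (s : Finset ι) {f : ι → E → F}
    (hf : ∀ i ∈ s, ContDiff ℝ ∞ (f i)) (w : E) :
    dirDeriv w (fun y => ∑ i ∈ s, f i y) = fun y => ∑ i ∈ s, dirDeriv w (f i) y := by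
  ext y
  simp only [dirDeriv]
  rw [fderiv_fun_sum fun i hi => (hf i hi).differentiable (by simp) y]
  simp

theorem hasDerivAt_comp_line {u : E → F} (hu : ContDiff ℝ ∞ u) (y w : E) (s : ℝ) :
    HasDerivAt (fun s : ℝ => u (y + s • w)) (dirDeriv w u (y + s • w)) s := by
  have h1 : HasDerivAt (fun t : ℝ => y + t • w) w s := by
    simpa using ((hasDerivAt_id s).smul_const w).const_add y
  exact (hu.differentiable (by simp) _).hasFDerivAt.comp_hasDerivAt s h1

theorem iteratedDeriv_comp_line {u : E → F} (hu : ContDiff ℝ ∞ u) (y w : E) (k : ℕ) :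
    iteratedDeriv k (fun s : ℝ => u (y + s • w)) = fun s => (dirDeriv w)^[k] u (y + s • w) := by
  induction k with
  | zero => simp
  | succ k ih =>
    ext s
    rw [iteratedDeriv_succ, ih, Function.iterate_succ_apply']
    exact (hasDerivAt_comp_line (contDiff_iterate_dirDeriv hu w k) y w s).deriv

variable [FiniteDimensional ℝ E] [MeasurableSpace E] [BorelSpace E] [CompleteSpace F]

theorem harmonicOnNhd_dirDeriv {u : E → F} (hu : HarmonicOnNhd u univ) (w : E) :
    HarmonicOnNhd (dirDeriv w u) univ := by
  have hs := contDiff_of_harmonic hu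
  have hD := contDiff_dirDeriv hs w
  have h2 : ∀ {f : E → F}, ContDiff ℝ ∞ f → ∀ y, ContDiffAt ℝ 2 f y := fun hf y =>
    (hf.of_le (mod_cast le_top : ((2 : ℕ∞) : WithTop ℕ∞) ≤ ∞)).contDiffAt
  let b := stdOrthonormalBasis ℝ E
  refine fun y _ => ⟨h2 hD y, Eventually.of_forall fun z => ?_⟩
  rw [laplacian_eq_sum_dirDeriv (h2 hD z) b]
  have h0 : (fun z => ∑ i, dirDeriv (b i) (dirDeriv (b i) u) z) = fun _ => 0 := by
    ext z
    rw [← laplacian_eq_sum_dirDeriv (h2 hs z) b, (hu z (mem_univ z)).2.self_of_nhds]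
    rfl
  have h1 := dirDeriv_fun_sum Finset.univ
    (f := fun i => dirDeriv (b i) (dirDeriv (b i) u))
    (fun i _ => contDiff_dirDeriv (contDiff_dirDeriv hs _) _) w
  rw [h0] at h1
  have h3 := congrFun h1 z
  simp only [Pi.zero_apply]
  calc _ = ∑ i, dirDeriv w (dirDeriv (b i) (dirDeriv (b i) u)) z := by
        refine Finset.sum_congr rfl fun i _ => ?_
        rw [dirDeriv_comm hs, dirDeriv_comm (contDiff_dirDeriv hs _)]
    _ = 0 := by rw [← h3]; simp [dirDeriv]

variable (E) in
/-- The dimensional constant in the interior gradient estimate for harmonic functions. -/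
noncomputable def gradConst : ℝ :=
  (∫ z : E, ‖fderiv ℝ (radialBump : E → ℝ) z‖) / ∫ z : E, radialBump z

variable (E) in
theorem gradConst_nonneg : 0 ≤ gradConst E :=
  div_nonneg (integral_nonneg fun _ => norm_nonneg _) integral_radialBump_pos.le

/-- Interior gradient estimate: the mean value property for the derivative, with the derivative
moved to the bump function. -/
theorem norm_dirDeriv_le {u : E → F} (hu : HarmonicOnNhd u univ) (w y : E) {r M : ℝ} (hr : 0 < r)
    (hM : ∀ z ∈ Metric.closedBall y r, ‖u z‖ ≤ M) :
    ‖dirDeriv w u y‖ ≤ gradConst E * ‖w‖ / r * M := by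
  have hs := contDiff_of_harmonic hu
  have hpos := integral_radialBump_pos (E := E)
  have hb := contDiff_radialBump (E := E)
  have hbs := hasCompactSupport_radialBump (E := E)
  have hM0 : 0 ≤ M := (norm_nonneg _).trans (hM y (Metric.mem_closedBall_self hr.le))
  have hmv := integral_radialBump_smul (harmonicOnNhd_dirDeriv hu w) y r
  let g : E → F := fun z => u (y + r • z)
  have hg : ContDiff ℝ ∞ g := hs.comp (by fun_prop)
  have hgd : ∀ z, fderiv ℝ g z w = r • dirDeriv w u (y + r • z) := by
    intro z
    have h1 : HasFDerivAt (fun z : E => y + r • z) (r • ContinuousLinearMap.id ℝ E) z :=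
      ((hasFDerivAt_id z).const_smul r).const_add y
    have h2 := ((hs.differentiable (by simp)) (y + r • z)).hasFDerivAt.comp z h1
    have h3 := h2.fderiv
    simp only [Function.comp_def] at h3
    simp only [g]
    rw [h3]
    simp [dirDeriv]
  have hbd : Continuous fun z : E => fderiv ℝ (radialBump : E → ℝ) z :=
    hb.continuous_fderiv (by simp)
  have hbds : HasCompactSupport (fderiv ℝ (radialBump : E → ℝ)) := hbs.fderiv ℝ
  have hparts := integral_smul_fderiv_eq_neg_fderiv_smul_of_integrable (μ := volume)
    (f := radialBump) (g := g) (v := w)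
    (Continuous.integrable_of_hasCompactSupport
      ((hbd.clm_apply continuous_const).smul hg.continuous)
      ((hbs.fderiv_apply ℝ w).smul_right))
    (Continuous.integrable_of_hasCompactSupport
      (hb.continuous.smul ((hg.continuous_fderiv (by simp)).clm_apply continuous_const))
      hbs.smul_right)
    (Continuous.integrable_of_hasCompactSupport (hb.continuous.smul hg.continuous) hbs.smul_right)
    (fun z _ => hb.differentiable (by simp) z) (fun z _ => hg.differentiable (by simp) z)
  have hle : ‖∫ z : E, fderiv ℝ radialBump z w • g z‖
      ≤ ∫ z : E, ‖fderiv ℝ (radialBump : E → ℝ) z‖ * (‖w‖ * M) := by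
    refine norm_integral_le_of_norm_le ?_ (Eventually.of_forall fun z => ?_)
    · exact Continuous.integrable_of_hasCompactSupport (by fun_prop) hbds.norm.mul_right
    · rw [norm_smul, ← mul_assoc]
      by_cases hz : z ∈ Metric.closedBall (0 : E) 1
      · refine mul_le_mul (ContinuousLinearMap.le_opNorm _ _) (hM _ ?_) (norm_nonneg _)
          (by positivity)
        simp only [Metric.mem_closedBall, dist_zero_right, dist_self_add_left] at hz ⊢
        rw [norm_smul, Real.norm_of_nonneg hr.le]
        nlinarith
      · have : fderiv ℝ (radialBump : E → ℝ) z = 0 := by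
          have hev : (radialBump : E → ℝ) =ᶠ[𝓝 z] fun _ => 0 := by
            filter_upwards [Metric.isClosed_closedBall.isOpen_compl.mem_nhds hz] with t ht
            exact radialBump_eq_zero ht
          rw [hev.fderiv_eq]
          simp
        rw [this]
        simp
  have hkey : (∫ z : E, radialBump z) • (r • dirDeriv w u y)
      = - ∫ z : E, fderiv ℝ radialBump z w • g z := by
    rw [← hparts, smul_comm, ← hmv, ← integral_smul]
    simp only [hgd]
    congr 1
    ext z
    rw [smul_comm]
  have hn : (∫ z : E, radialBump z) * (r * ‖dirDeriv w u y‖)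
      ≤ (∫ z : E, ‖fderiv ℝ (radialBump : E → ℝ) z‖) * (‖w‖ * M) := by
    rw [integral_mul_const] at hle
    refine le_trans (le_of_eq ?_) hle
    have := congrArg norm hkey
    rwa [norm_neg, norm_smul, norm_smul, Real.norm_of_nonneg hpos.le,
      Real.norm_of_nonneg hr.le] at this
  have heq : gradConst E * ‖w‖ / r * M = (∫ z : E, ‖fderiv ℝ (radialBump : E → ℝ) z‖) * (‖w‖ * M)
      / ((∫ z : E, radialBump z) * r) := by
    rw [gradConst]
    field_simp
  rw [heq, le_div_iff₀ (by positivity)]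
  linarith

theorem norm_iterate_dirDeriv_le (w : E) {r M : ℝ} (hr : 0 < r) (k : ℕ) {u : E → F}
    (hu : HarmonicOnNhd u univ) (y : E)
    (hM : ∀ z ∈ Metric.closedBall y (k * r), ‖u z‖ ≤ M) :
    ‖(dirDeriv w)^[k] u y‖ ≤ (gradConst E * ‖w‖ / r) ^ k * M := by
  induction k generalizing u M with
  | zero => simpa using hM y (by simp)
  | succ k ih =>
    rw [Function.iterate_succ_apply, pow_succ, mul_assoc]
    refine ih (harmonicOnNhd_dirDeriv hu w) fun z hz => norm_dirDeriv_le hu w z hr fun t ht => ?_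
    refine hM t ?_
    simp only [Metric.mem_closedBall] at *
    push_cast
    linarith [dist_triangle t z y]

/-- Harmonic functions are locally given by their Taylor series along lines: the `k`-th derivative
is estimated by `k` gradient estimates on balls of radius `1 / k`, and `k ^ k / k! ≤ e ^ k`. -/
theorem hasSum_taylor_of_harmonic {u : E → F} (hu : HarmonicOnNhd u univ) (y w : E)
    (hw1 : ‖w‖ ≤ 1) (hw : gradConst E * ‖w‖ * Real.exp 1 ≤ 1 / 2) :
    HasSum (fun k : ℕ => (k.factorial : ℝ)⁻¹ • (dirDeriv w)^[k] u y) (u (y + w)) := by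
  have hs := contDiff_of_harmonic hu
  obtain ⟨M, hM⟩ := (isCompact_closedBall y 2).exists_bound_of_continuousOn
    hs.continuous.continuousOn
  have hM0 : 0 ≤ M := (norm_nonneg _).trans (hM y (Metric.mem_closedBall_self (by norm_num)))
  have hL := gradConst_nonneg E
  set a := gradConst E * ‖w‖ with ha
  have ha0 : 0 ≤ a := by positivity
  have hbound : ∀ (k : ℕ) (s : ℝ), s ∈ Icc (0 : ℝ) 1 →
      ‖(dirDeriv w)^[k] u (y + s • w)‖ ≤ k.factorial * ((1 / 2) ^ k * M) := by
    intro k s hs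
    have h1 : ‖(dirDeriv w)^[k] u (y + s • w)‖ ≤ (a * k) ^ k * M := by
      have hMk : ∀ z ∈ Metric.closedBall (y + s • w) 1, ‖u z‖ ≤ M := by
        intro z hz
        apply hM
        have : dist (y + s • w) y ≤ 1 := by
          simp only [dist_self_add_left, norm_smul, Real.norm_of_nonneg hs.1]
          nlinarith [hs.1, hs.2, norm_nonneg w]
        simp only [Metric.mem_closedBall] at *
        linarith [dist_triangle z (y + s • w) y]
      rcases Nat.eq_zero_or_pos k with rfl | hk
      · simpa using hMk _ (Metric.mem_closedBall_self (by norm_num))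
      · have hk' : (0 : ℝ) < k := by exact_mod_cast hk
        have := norm_iterate_dirDeriv_le w (inv_pos.2 hk') k hu (y + s • w) (M := M)
          (by rwa [mul_inv_cancel₀ hk'.ne'])
        rwa [div_inv_eq_mul] at this
    refine h1.trans ?_
    have h2 : (k : ℝ) ^ k ≤ k.factorial * Real.exp 1 ^ k := by
      have := Real.pow_div_factorial_le_exp (k : ℝ) (by positivity) k
      rw [div_le_iff₀ (by positivity)] at this
      rw [← Real.exp_nat_mul, mul_one]
      linarith
    calc (a * k) ^ k * M = a ^ k * (k : ℝ) ^ k * M := by rw [mul_pow]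
      _ ≤ a ^ k * (k.factorial * Real.exp 1 ^ k) * M := by gcongr
      _ = k.factorial * ((a * Real.exp 1) ^ k * M) := by rw [mul_pow]; ring
      _ ≤ _ := by gcongr
  have hsum : Summable (fun k : ℕ => (k.factorial : ℝ)⁻¹ • (dirDeriv w)^[k] u y) := by
    refine Summable.of_norm_bounded (g := fun k : ℕ => (1 / 2 : ℝ) ^ k * M)
      ((summable_geometric_of_lt_one (by norm_num) (by norm_num)).mul_right M) fun k => ?_
    have := hbound k 0 (by simp)
    rw [zero_smul, add_zero] at this
    rw [norm_smul, norm_inv, Real.norm_of_nonneg (by positivity), inv_mul_le_iff₀ (by positivity)]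
    exact this
  let φ : ℝ → F := fun s => u (y + s • w)
  have hφ : ContDiff ℝ ∞ φ := hs.comp (by fun_prop)
  have hder : ∀ k : ℕ, ∀ s ∈ Icc (0 : ℝ) 1,
      iteratedDerivWithin k φ (Icc 0 1) s = (dirDeriv w)^[k] u (y + s • w) := by
    intro k s hs'
    rw [iteratedDerivWithin_eq_iteratedDeriv (uniqueDiffOn_Icc zero_lt_one)
      (hφ.contDiffAt.of_le (by exact_mod_cast le_top)) hs', iteratedDeriv_comp_line hs]
  have hrem : ∀ n : ℕ, ‖u (y + w) - ∑ k ∈ Finset.range (n + 1),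
      (k.factorial : ℝ)⁻¹ • (dirDeriv w)^[k] u y‖ ≤ (n + 1) * (1 / 2) ^ (n + 1) * M := by
    intro n
    have := taylor_mean_remainder_bound (f := φ) (a := 0) (b := 1) (x := 1) (n := n)
      (C := (n + 1).factorial * ((1 / 2) ^ (n + 1) * M)) zero_le_one
      ((hφ.of_le (by exact_mod_cast le_top)).contDiffOn) (by simp)
      (fun s hs' => by rw [hder _ _ hs']; exact hbound _ s hs')
    rw [taylor_within_apply] at this
    simp only [sub_zero, one_pow, mul_one] at this
    have he : ∀ k : ℕ, iteratedDerivWithin k φ (Icc 0 1) 0 = (dirDeriv w)^[k] u y := by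
      intro k
      rw [hder k 0 (by simp)]
      simp
    simp only [he, φ, one_smul] at this
    refine this.trans (le_of_eq ?_)
    rw [Nat.factorial_succ]
    push_cast
    field_simp
  have hlim : Tendsto (fun n : ℕ => ((n : ℝ) + 1) * (1 / 2) ^ (n + 1) * M) atTop (𝓝 0) := by
    have h1 := tendsto_self_mul_const_pow_of_lt_one (r := (1 / 2 : ℝ)) (by norm_num) (by norm_num)
    have h2 := ((tendsto_add_atTop_iff_nat 1).2 h1).mul_const M
    simpa using h2
  have ht : Tendsto (fun n : ℕ => ∑ k ∈ Finset.range (n + 1),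
      (k.factorial : ℝ)⁻¹ • (dirDeriv w)^[k] u y) atTop (𝓝 (u (y + w))) := by
    rw [tendsto_iff_norm_sub_tendsto_zero]
    refine squeeze_zero (fun n => norm_nonneg _) (fun n => ?_) hlim
    rw [norm_sub_rev]
    exact hrem n
  have h3 := (tendsto_add_atTop_iff_nat 1).2 hsum.hasSum.tendsto_sum_nat
  rw [← tendsto_nhds_unique h3 ht]
  exact hsum.hasSum

/-- A harmonic function restricted to a line is real analytic, with the expected Taylor
coefficients. -/
theorem hasFPowerSeriesAt_of_harmonic {u : E → F} (hu : HarmonicOnNhd u univ) (y w : E) (t : ℝ) :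
    HasFPowerSeriesAt (fun s : ℝ => u (y + s • w))
      (powerSeriesOfCoeff fun k => (k.factorial : ℝ)⁻¹ • (dirDeriv w)^[k] u (y + t • w)) t := by
  rw [hasFPowerSeriesAt_iff]
  have h1 : ∀ᶠ z : ℝ in 𝓝 0, ‖z • w‖ < 1 := by
    have : Tendsto (fun z : ℝ => ‖z • w‖) (𝓝 0) (𝓝 ‖(0 : ℝ) • w‖) :=
      (by fun_prop : Continuous fun z : ℝ => ‖z • w‖).tendsto 0
    exact this.eventually_lt_const (by simp)
  have h2 : ∀ᶠ z : ℝ in 𝓝 0, gradConst E * ‖z • w‖ * Real.exp 1 < 1 / 2 := by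
    have : Tendsto (fun z : ℝ => gradConst E * ‖z • w‖ * Real.exp 1) (𝓝 0)
        (𝓝 (gradConst E * ‖(0 : ℝ) • w‖ * Real.exp 1)) :=
      (by fun_prop : Continuous fun z : ℝ => gradConst E * ‖z • w‖ * Real.exp 1).tendsto 0
    exact this.eventually_lt_const (by simp)
  filter_upwards [h1, h2] with z hz1 hz2
  have := hasSum_taylor_of_harmonic hu (y + t • w) (z • w) hz1.le hz2.le
  rw [add_assoc, ← add_smul] at this
  convert! this using 2 with k
  rw [iterate_dirDeriv_smul_left z w (contDiff_of_harmonic hu)]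
  rw [coeff_powerSeriesOfCoeff, Pi.smul_apply, smul_comm]

end Taylor

/-! ### Multi-index derivatives -/

section Coordinates

variable {n : ℕ}

theorem partialDeriv_eq_dirDeriv {u : EuclideanSpace ℝ (Fin n) → ℂ} (hu : ContDiff ℝ ∞ u)
    (j : Fin n) : partialDeriv j u = dirDeriv (EuclideanSpace.single j 1) u := by
  ext x
  exact (hu.differentiable (by simp) x).lineDeriv_eq_fderiv

theorem contDiff_partialDeriv {u : EuclideanSpace ℝ (Fin n) → ℂ} (hu : ContDiff ℝ ∞ u)
    (j : Fin n) : ContDiff ℝ ∞ (partialDeriv j u) := by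
  rw [partialDeriv_eq_dirDeriv hu]
  exact contDiff_dirDeriv hu _

theorem contDiff_iterate_partialDeriv {u : EuclideanSpace ℝ (Fin n) → ℂ} (hu : ContDiff ℝ ∞ u)
    (j : Fin n) (k : ℕ) : ContDiff ℝ ∞ ((partialDeriv j)^[k] u) := by
  induction k with
  | zero => simpa
  | succ k ih => rw [Function.iterate_succ_apply']; exact contDiff_partialDeriv ih j

theorem partialDeriv_comm {u : EuclideanSpace ℝ (Fin n) → ℂ} (hu : ContDiff ℝ ∞ u)
    (i j : Fin n) : partialDeriv i (partialDeriv j u) = partialDeriv j (partialDeriv i u) := by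
  rw [partialDeriv_eq_dirDeriv (contDiff_partialDeriv hu j),
    partialDeriv_eq_dirDeriv (contDiff_partialDeriv hu i), partialDeriv_eq_dirDeriv hu,
    partialDeriv_eq_dirDeriv hu, dirDeriv_comm hu]

theorem partialDeriv_iterate_comm {u : EuclideanSpace ℝ (Fin n) → ℂ} (hu : ContDiff ℝ ∞ u)
    (i j : Fin n) (k : ℕ) :
    partialDeriv i ((partialDeriv j)^[k] u) = (partialDeriv j)^[k] (partialDeriv i u) := by
  induction k with
  | zero => rfl
  | succ k ih =>
    rw [Function.iterate_succ_apply', Function.iterate_succ_apply',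
      partialDeriv_comm (contDiff_iterate_partialDeriv hu j k), ih]

/-- The composition of the operators `∂_j ^ β_j` for `j` in a list of coordinates; the full list
gives `multiDeriv`. -/
noncomputable def listDeriv (β : Fin n → ℕ) (u : EuclideanSpace ℝ (Fin n) → ℂ)
    (l : List (Fin n)) : EuclideanSpace ℝ (Fin n) → ℂ :=
  l.foldr (fun j g => (partialDeriv j)^[β j] g) u

theorem contDiff_listDeriv {u : EuclideanSpace ℝ (Fin n) → ℂ} (hu : ContDiff ℝ ∞ u)
    (β : Fin n → ℕ) (l : List (Fin n)) : ContDiff ℝ ∞ (listDeriv β u l) := by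
  induction l with
  | nil => exact hu
  | cons j l ih => exact contDiff_iterate_partialDeriv ih j _

theorem listDeriv_add_single_of_notMem (u : EuclideanSpace ℝ (Fin n) → ℂ) (β : Fin n → ℕ)
    (i : Fin n) {l : List (Fin n)} (hi : i ∉ l) :
    listDeriv (β + Pi.single i 1) u l = listDeriv β u l := by
  induction l with
  | nil => rfl
  | cons j l ih =>
    simp only [List.mem_cons, not_or] at hi
    have hj : (β + Pi.single i 1 : Fin n → ℕ) j = β j := by
      simp [Ne.symm hi.1]
    have h := ih hi.2
    simp only [listDeriv, List.foldr_cons] at h ⊢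
    rw [h, hj]

theorem partialDeriv_listDeriv {u : EuclideanSpace ℝ (Fin n) → ℂ} (hu : ContDiff ℝ ∞ u)
    (β : Fin n → ℕ) (i : Fin n) {l : List (Fin n)} (hl : l.Nodup) (hi : i ∈ l) :
    partialDeriv i (listDeriv β u l) = listDeriv (β + Pi.single i 1) u l := by
  induction l with
  | nil => simp at hi
  | cons j l ih =>
    rw [List.nodup_cons] at hl
    change partialDeriv i ((partialDeriv j)^[β j] (listDeriv β u l))
      = (partialDeriv j)^[(β + Pi.single i 1 : Fin n → ℕ) j] (listDeriv (β + Pi.single i 1) u l)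
    by_cases hij : i = j
    · subst hij
      rw [listDeriv_add_single_of_notMem u β i hl.1, Pi.add_apply, Pi.single_eq_same,
        Function.iterate_succ_apply']
    · have hj : (β + Pi.single i 1 : Fin n → ℕ) j = β j := by
        simp [Ne.symm hij]
      rw [partialDeriv_iterate_comm (contDiff_listDeriv hu β l), hj,
        ih hl.2 ((List.mem_cons.1 hi).resolve_left hij)]

theorem contDiff_multiDeriv {u : EuclideanSpace ℝ (Fin n) → ℂ} (hu : ContDiff ℝ ∞ u)
    (β : Fin n → ℕ) : ContDiff ℝ ∞ (multiDeriv β u) :=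
  contDiff_listDeriv hu β _

theorem dirDeriv_single_multiDeriv {u : EuclideanSpace ℝ (Fin n) → ℂ} (hu : ContDiff ℝ ∞ u)
    (β : Fin n → ℕ) (i : Fin n) :
    dirDeriv (EuclideanSpace.single i 1) (multiDeriv β u) = multiDeriv (β + Pi.single i 1) u := by
  rw [← partialDeriv_eq_dirDeriv (contDiff_multiDeriv hu β)]
  exact partialDeriv_listDeriv hu β i (List.nodup_finRange n) (List.mem_finRange i)

theorem multiDeriv_zero (u : EuclideanSpace ℝ (Fin n) → ℂ) : multiDeriv 0 u = u := by
  have : ∀ l : List (Fin n), listDeriv 0 u l = u := by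
    intro l
    induction l with
    | nil => rfl
    | cons j l ih => exact ih
  exact this _

theorem harmonicOnNhd_multiDeriv {u : EuclideanSpace ℝ (Fin n) → ℂ}
    (hu : HarmonicOnNhd u univ) (β : Fin n → ℕ) : HarmonicOnNhd (multiDeriv β u) univ := by
  have hit : ∀ (j : Fin n) (k : ℕ) {f : EuclideanSpace ℝ (Fin n) → ℂ}, HarmonicOnNhd f univ →
      HarmonicOnNhd ((partialDeriv j)^[k] f) univ := by
    intro j k f hf
    induction k with
    | zero => exact hf
    | succ k ih =>
      rw [Function.iterate_succ_apply', partialDeriv_eq_dirDeriv (contDiff_of_harmonic ih)]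
      exact harmonicOnNhd_dirDeriv ih _
  have : ∀ l : List (Fin n), HarmonicOnNhd (listDeriv β u l) univ := by
    intro l
    induction l with
    | nil => exact hu
    | cons j l ih => exact hit j _ ih
  exact this _

/-- Harmonicity of `∂^β u` as a linear relation between the derivatives of `u` at a point. -/
theorem sum_multiDeriv_add_two_single {u : EuclideanSpace ℝ (Fin n) → ℂ}
    (hu : HarmonicOnNhd u univ) (β : Fin n → ℕ) (x : EuclideanSpace ℝ (Fin n)) :
    ∑ j, multiDeriv (β + Pi.single j 1 + Pi.single j 1) u x = 0 := by
  have hs := contDiff_of_harmonic hu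
  have hβ := (harmonicOnNhd_multiDeriv hu β) x (mem_univ x)
  have h1 := laplacian_eq_sum_dirDeriv hβ.1 (EuclideanSpace.basisFun (Fin n) ℝ)
  rw [hβ.2.self_of_nhds] at h1
  simpa [dirDeriv_single_multiDeriv hs] using h1.symm

theorem dirDeriv_multiDeriv {u : EuclideanSpace ℝ (Fin n) → ℂ} (hu : ContDiff ℝ ∞ u)
    (w : EuclideanSpace ℝ (Fin n)) (β : Fin n → ℕ) (y : EuclideanSpace ℝ (Fin n)) :
    dirDeriv w (multiDeriv β u) y = ∑ j, (w j : ℂ) * multiDeriv (β + Pi.single j 1) u y := by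
  simp only [← dirDeriv_single_multiDeriv hu, dirDeriv]
  have hw : w = ∑ j, w j • EuclideanSpace.single j (1 : ℝ) := by
    have := ((EuclideanSpace.basisFun (Fin n) ℝ).sum_repr w).symm
    simpa using this
  conv_lhs => rw [hw]
  simp

/-- Reindexing of a sum over multi-indices of order `k + 1` with a marked unit: removing the unit
gives a multi-index of order `k` and a coordinate. -/
theorem sum_piAntidiag_succ (k : ℕ) (f : (Fin n → ℕ) → Fin n → ℂ)
    (hf : ∀ η j, η j = 0 → f η j = 0) :
    ∑ η ∈ Finset.piAntidiag Finset.univ (k + 1), ∑ j, f η j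
      = ∑ β ∈ Finset.piAntidiag Finset.univ k, ∑ j, f (β + Pi.single j 1) j := by
  rw [Finset.sum_comm, Finset.sum_comm (s := Finset.piAntidiag Finset.univ k)]
  refine Finset.sum_congr rfl fun j _ => ?_
  symm
  refine Finset.sum_of_injOn (fun β => β + Pi.single j 1) ?_ ?_ ?_ ?_
  · exact fun a _ b _ h => add_right_cancel h
  · intro β hβ
    simp only [Finset.mem_coe, Finset.mem_piAntidiag] at hβ ⊢
    simp_all [Finset.sum_add_distrib]
  · intro η hη hne
    apply hf
    by_contra h0
    apply hne
    simp only [Finset.mem_piAntidiag] at hη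
    refine ⟨η - Pi.single j 1, ?_, ?_⟩
    · have hle : ∀ i, (Pi.single j 1 : Fin n → ℕ) i ≤ η i := by
        intro i
        by_cases hi : i = j
        · subst hi; simp; omega
        · simp [hi]
      simp only [Finset.mem_coe, Finset.mem_piAntidiag, Pi.sub_apply]
      rw [Finset.sum_tsub_distrib _ fun i _ => hle i, hη.1]
      simp
    · ext i
      by_cases hi : i = j
      · subst hi; simp; omega
      · simp [hi]
  · intro β _
    rfl

theorem multiFactorial_add_single (β : Fin n → ℕ) (j : Fin n) :
    multiFactorial (β + Pi.single j 1) = (β j + 1) * multiFactorial β := by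
  unfold multiFactorial
  rw [← Finset.mul_prod_erase _ _ (Finset.mem_univ j),
    ← Finset.mul_prod_erase _ (fun j => (β j).factorial) (Finset.mem_univ j), ← mul_assoc]
  congr 1
  · simp [Nat.factorial_succ]
  · refine Finset.prod_congr rfl fun i hi => ?_
    simp [(Finset.mem_erase.1 hi).1]

theorem prod_pow_add_single {R : Type*} [CommSemiring R] (w : Fin n → R) (β : Fin n → ℕ)
    (j : Fin n) : ∏ i, w i ^ (β + Pi.single j 1 : Fin n → ℕ) i = w j * ∏ i, w i ^ β i := by
  simp only [Pi.add_apply, pow_add, Finset.prod_mul_distrib]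
  rw [mul_comm]
  congr 1
  rw [Finset.prod_eq_single j]
  · simp
  · intro i _ hi
    simp [hi]
  · simp

theorem multiFactorial_pos (β : Fin n → ℕ) : 0 < multiFactorial β :=
  Finset.prod_pos fun _ _ => Nat.factorial_pos _

/-- Multinomial expansion of iterated directional derivatives. -/
theorem iterate_dirDeriv_eq_sum {u : EuclideanSpace ℝ (Fin n) → ℂ} (hu : ContDiff ℝ ∞ u)
    (w : EuclideanSpace ℝ (Fin n)) (k : ℕ) :
    (dirDeriv w)^[k] u = fun y => (k.factorial : ℂ) *
      ∑ β ∈ Finset.piAntidiag Finset.univ k,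
        (∏ j, (w j : ℂ) ^ β j) / (multiFactorial β : ℂ) * multiDeriv β u y := by
  induction k with
  | zero =>
    ext y
    simp [multiFactorial, multiDeriv_zero]
  | succ k ih =>
    ext y
    rw [Function.iterate_succ_apply', ih]
    have h1 : dirDeriv w (fun y => (k.factorial : ℂ) * ∑ β ∈ Finset.piAntidiag Finset.univ k,
        (∏ j, (w j : ℂ) ^ β j) / (multiFactorial β : ℂ) * multiDeriv β u y) y
        = (k.factorial : ℂ) * ∑ β ∈ Finset.piAntidiag Finset.univ k,
        (∏ j, (w j : ℂ) ^ β j) / (multiFactorial β : ℂ) * dirDeriv w (multiDeriv β u) y := by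
      have hd : ∀ β, DifferentiableAt ℝ (multiDeriv β u) y := fun β =>
        (contDiff_multiDeriv hu β).differentiable (by simp) y
      simp only [dirDeriv]
      rw [fderiv_const_mul (by fun_prop), fderiv_fun_sum (fun β _ => by fun_prop)]
      simp only [smul_apply, sum_apply, smul_eq_mul]
      congr 1
      refine Finset.sum_congr rfl fun β _ => ?_
      rw [fderiv_const_mul (hd β)]
      simp
    rw [h1]
    have h2 := sum_piAntidiag_succ (n := n) k
      (fun η j => (η j : ℂ) * ((∏ i, (w i : ℂ) ^ η i) / (multiFactorial η : ℂ)
        * multiDeriv η u y)) (by intro η j h; simp [h])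
    have h3 : ∀ η ∈ Finset.piAntidiag (Finset.univ : Finset (Fin n)) (k + 1),
        ∑ j, (η j : ℂ) * ((∏ i, (w i : ℂ) ^ η i) / (multiFactorial η : ℂ) * multiDeriv η u y)
        = ((k + 1 : ℕ) : ℂ) *
          ((∏ i, (w i : ℂ) ^ η i) / (multiFactorial η : ℂ) * multiDeriv η u y) := by
      intro η hη
      rw [← Finset.sum_mul, ← (Finset.mem_piAntidiag.1 hη).1]
      push_cast
      rfl
    rw [Finset.sum_congr rfl h3, ← Finset.mul_sum] at h2
    rw [Nat.factorial_succ, mul_comm (k + 1), Nat.cast_mul, mul_assoc, h2]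
    congr 1
    refine Finset.sum_congr rfl fun β _ => ?_
    rw [dirDeriv_multiDeriv hu, Finset.mul_sum]
    refine Finset.sum_congr rfl fun j _ => ?_
    rw [prod_pow_add_single, multiFactorial_add_single]
    have h4 : (multiFactorial β : ℂ) ≠ 0 := by exact_mod_cast (multiFactorial_pos β).ne'
    have h5 : ((β j : ℂ) + 1) ≠ 0 := by exact_mod_cast Nat.succ_ne_zero (β j)
    simp only [Pi.add_apply, Pi.single_eq_same]
    push_cast
    field_simp

end Coordinates

/-! ### Power series in several complex variables -/

section Entire

variable {n : ℕ}

/-- A family over multi-indices is summed by grouping the multi-indices of equal order. -/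
theorem hasSum_piAntidiag {α : Type*} [AddCommMonoid α] [TopologicalSpace α]
    [ContinuousAdd α] [RegularSpace α] {f : (Fin n → ℕ) → α} {a : α} (hf : HasSum f a) :
    HasSum (fun k : ℕ => ∑ β ∈ Finset.piAntidiag Finset.univ k, f β) a := by
  let e : (Σ k : ℕ, (Finset.piAntidiag (Finset.univ : Finset (Fin n)) k)) ≃ (Fin n → ℕ) :=
    { toFun := fun p => p.2.1
      invFun := fun β => ⟨∑ j, β j, β, by simp⟩
      left_inv := by
        rintro ⟨k, β, hβ⟩
        obtain ⟨rfl, -⟩ := Finset.mem_piAntidiag.1 hβ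
        rfl
      right_inv := fun _ => rfl }
  refine ((e.hasSum_iff).2 hf).sigma fun k => ?_
  exact Finset.hasSum _ f

theorem exists_monomialForm {k : ℕ} {β : Fin n → ℕ}
    (hβ : β ∈ Finset.piAntidiag (Finset.univ : Finset (Fin n)) k) :
    ∃ M : ContinuousMultilinearMap ℂ (fun _ : Fin k => Fin n → ℂ) ℂ,
      ‖M‖ ≤ 1 ∧ ∀ z, M (fun _ => z) = ∏ j, z j ^ β j := by
  obtain ⟨rfl, -⟩ := Finset.mem_piAntidiag.1 hβ
  let σ : Fin (∑ j, β j) → Fin n := fun i => (finSigmaFinEquiv.symm i).1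
  refine ⟨(ContinuousMultilinearMap.mkPiAlgebra ℂ (Fin (∑ j, β j)) ℂ).compContinuousLinearMap
    (fun i => ContinuousLinearMap.proj (σ i)), ?_, fun z => ?_⟩
  · refine ContinuousMultilinearMap.opNorm_le_bound zero_le_one fun v => ?_
    simp only [ContinuousMultilinearMap.compContinuousLinearMap_apply,
      ContinuousMultilinearMap.mkPiAlgebra_apply, ContinuousLinearMap.proj_apply, norm_prod,
      one_mul]
    exact Finset.prod_le_prod (fun _ _ => norm_nonneg _) fun i _ => norm_le_pi_norm _ _
  · simp only [ContinuousMultilinearMap.compContinuousLinearMap_apply,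
      ContinuousMultilinearMap.mkPiAlgebra_apply, ContinuousLinearMap.proj_apply]
    rw [← Equiv.prod_comp finSigmaFinEquiv]
    simp [σ, Fintype.prod_sigma]

/-- The sum of the power series with coefficients `c` in `n` complex variables. -/
noncomputable def multiSeries (c : (Fin n → ℕ) → ℂ) (z : Fin n → ℂ) : ℂ :=
  ∑' β, c β * ∏ j, z j ^ β j

theorem norm_prod_pow_le {z : Fin n → ℂ} {r : ℝ} (hr : ∀ j, ‖z j‖ ≤ r) (β : Fin n → ℕ) :
    ‖∏ j, z j ^ β j‖ ≤ r ^ ∑ j, β j := by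
  rw [norm_prod, ← Finset.prod_pow_eq_pow_sum]
  refine Finset.prod_le_prod (fun _ _ => norm_nonneg _) fun j _ => ?_
  rw [norm_pow]
  gcongr
  exact hr j

theorem summable_multiSeries {c : (Fin n → ℕ) → ℂ}
    (hc : ∀ r : ℝ, 0 ≤ r → Summable fun β => ‖c β‖ * r ^ ∑ j, β j) (z : Fin n → ℂ) :
    Summable fun β => c β * ∏ j, z j ^ β j := by
  refine Summable.of_norm_bounded (hc ‖z‖ (norm_nonneg _)) fun β => ?_
  rw [norm_mul]
  gcongr
  exact norm_prod_pow_le (fun j => norm_le_pi_norm _ _) β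

theorem analyticOnNhd_multiSeries {c : (Fin n → ℕ) → ℂ}
    (hc : ∀ r : ℝ, 0 ≤ r → Summable fun β => ‖c β‖ * r ^ ∑ j, β j) :
    AnalyticOnNhd ℂ (multiSeries c) univ := by
  choose! M hM1 hM using fun (k : ℕ) (β : Fin n → ℕ) => exists_monomialForm (k := k) (β := β)
  let p : FormalMultilinearSeries ℂ (Fin n → ℂ) ℂ := fun k =>
    ∑ β ∈ Finset.piAntidiag Finset.univ k, c β • M k β
  have hrad : p.radius = ⊤ := by
    refine p.radius_eq_top_of_summable_norm fun r => ?_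
    refine Summable.of_nonneg_of_le (fun k => by positivity) (fun k => ?_)
      (hasSum_piAntidiag (hc r r.2).hasSum).summable
    calc ‖p k‖ * (r : ℝ) ^ k ≤ (∑ β ∈ Finset.piAntidiag Finset.univ k, ‖c β‖) * (r : ℝ) ^ k := by
          gcongr
          refine norm_sum_le_of_le _ fun β hβ => ?_
          rw [norm_smul]
          exact mul_le_of_le_one_right (norm_nonneg _) (hM1 k β hβ)
      _ = _ := by
          rw [Finset.sum_mul]
          refine Finset.sum_congr rfl fun β hβ => ?_
          rw [(Finset.mem_piAntidiag.1 hβ).1]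
  have hp : HasFPowerSeriesOnBall (multiSeries c) p 0 ⊤ :=
    { r_le := hrad.ge
      r_pos := ENNReal.zero_lt_top
      hasSum := by
        intro z _
        rw [zero_add]
        convert! hasSum_piAntidiag (summable_multiSeries hc z).hasSum using 2 with k
        simp only [p, sum_apply, smul_apply]
        exact Finset.sum_congr rfl fun β hβ => by rw [hM k β hβ, smul_eq_mul] }
  have := hp.analyticOnNhd
  rwa [Metric.eball_top] at this

/-- A harmonic function whose Taylor series at `x` converges everywhere is the sum of that
series: both sides are real analytic along the line from `x` to `y` with the same Taylor
coefficients at `x`. -/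
theorem eq_multiSeries_of_harmonic {u : EuclideanSpace ℝ (Fin n) → ℂ}
    (hu : HarmonicOnNhd u univ) (x : EuclideanSpace ℝ (Fin n))
    (hc : ∀ r : ℝ, 0 ≤ r → Summable fun β : Fin n → ℕ =>
      ‖multiDeriv β u x / (multiFactorial β : ℂ)‖ * r ^ ∑ j, β j)
    (y : EuclideanSpace ℝ (Fin n)) :
    u y = multiSeries (fun β => multiDeriv β u x / (multiFactorial β : ℂ))
      (fun j => (y j : ℂ) - (x j : ℂ)) := by
  set c : (Fin n → ℕ) → ℂ := fun β => multiDeriv β u x / (multiFactorial β : ℂ)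
  have hs := contDiff_of_harmonic hu
  let w := y - x
  let g : ℝ → ℂ := fun t => u (x + t • w)
  let G : ℝ → ℂ := fun t => multiSeries c (fun j => (t : ℂ) * (w j : ℂ))
  have hg : AnalyticOnNhd ℝ g univ := fun t _ => (hasFPowerSeriesAt_of_harmonic hu x w t).analyticAt
  have hG : AnalyticOnNhd ℝ G univ := by
    intro t _
    let A : ℝ →L[ℝ] (Fin n → ℂ) :=
      ContinuousLinearMap.pi fun j => Complex.ofRealCLM.smulRight (w j : ℂ)
    have h1 := (analyticOnNhd_multiSeries hc (A t) (mem_univ _)).restrictScalars (𝕜 := ℝ)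
    exact h1.comp (A.analyticAt t)
  have hev : g =ᶠ[𝓝 0] G := by
    have h1 := (hasFPowerSeriesAt_iff.1 (hasFPowerSeriesAt_of_harmonic hu x w 0))
    filter_upwards [h1] with t ht
    rw [zero_add] at ht
    refine ht.unique ?_
    have h2 := hasSum_piAntidiag (summable_multiSeries hc fun j => (t : ℂ) * (w j : ℂ)).hasSum
    convert! h2 using 2 with k
    rw [coeff_powerSeriesOfCoeff, iterate_dirDeriv_eq_sum hs, zero_smul, add_zero,
      Complex.real_smul, Complex.real_smul]
    push_cast
    rw [inv_mul_cancel_left₀ (by exact_mod_cast (Nat.factorial_pos k).ne'), Finset.mul_sum]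
    refine Finset.sum_congr rfl fun β hβ => ?_
    simp only [mul_pow, Finset.prod_mul_distrib]
    rw [Finset.prod_pow_eq_pow_sum, (Finset.mem_piAntidiag.1 hβ).1]
    ring
  have := congrFun (hg.eq_of_eventuallyEq hG hev) 1
  simp only [g, G, w] at this
  simpa using this

/-- An entire function vanishing on `ℝ ^ n` vanishes: along `ζ ↦ a + ζ b` with `a`, `b` real it has
non-isolated zeros. -/
theorem eq_of_eq_on_real {v₁ v₂ : (Fin n → ℂ) → ℂ} (h₁ : AnalyticOnNhd ℂ v₁ univ)
    (h₂ : AnalyticOnNhd ℂ v₂ univ) (h : ∀ x : Fin n → ℝ, v₁ (fun j => x j) = v₂ (fun j => x j)) :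
    v₁ = v₂ := by
  ext z
  let A : ℂ → Fin n → ℂ := fun ζ j => (z j).re + ζ * (z j).im
  have hA : AnalyticOnNhd ℂ A univ := by
    refine AnalyticOnNhd.pi fun j => ?_
    intro ζ _
    fun_prop
  have e1 : AnalyticOnNhd ℂ (v₁ ∘ A) univ := h₁.comp hA fun _ _ => mem_univ _
  have e2 : AnalyticOnNhd ℂ (v₂ ∘ A) univ := h₂.comp hA fun _ _ => mem_univ _
  have hfreq : ∃ᶠ ζ in 𝓝[≠] (0 : ℂ), (v₁ ∘ A) ζ = (v₂ ∘ A) ζ := by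
    have ht : Tendsto (fun t : ℝ => (t : ℂ)) (𝓝[≠] 0) (𝓝[≠] 0) := by
      refine tendsto_nhdsWithin_iff.2 ⟨?_, ?_⟩
      · exact (Complex.continuous_ofReal.tendsto' 0 0 (by simp)).mono_left nhdsWithin_le_nhds
      · filter_upwards [self_mem_nhdsWithin] with t ht
        simpa using ht
    refine ht.frequently (Eventually.frequently (Eventually.of_forall fun t => ?_))
    simpa [A] using h fun j => (z j).re + t * (z j).im
  have := congrFun (e1.eq_of_frequently_eq e2 hfreq) Complex.I
  have hz : A Complex.I = z := by
    ext j
    simp only [A]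
    rw [mul_comm, Complex.re_add_im]
  simpa [hz] using this

end Entire

/-! ### Products of series -/

section Products

/-- A product of absolutely convergent series, as a series over `ι ^ n`. -/
theorem hasSum_prod_pi {ι : Type*} {n : ℕ} (f : Fin n → ι → ℂ)
    (hf : ∀ j, Summable fun i => ‖f j i‖) :
    (Summable fun m : Fin n → ι => ‖∏ j, f j (m j)‖) ∧
      HasSum (fun m : Fin n → ι => ∏ j, f j (m j)) (∏ j, ∑' i, f j i) := by
  induction n with
  | zero =>
    simp only [Finset.univ_eq_empty, Finset.prod_empty]
    exact ⟨(hasSum_fintype _).summable, by simp⟩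
  | succ n ih =>
    obtain ⟨h1, h2⟩ := ih (fun j => f j.succ) fun j => hf j.succ
    obtain ⟨e, he0, hes⟩ : ∃ e : ι × (Fin n → ι) ≃ (Fin (n + 1) → ι),
        (∀ p, e p 0 = p.1) ∧ ∀ p (j : Fin n), e p j.succ = p.2 j :=
      ⟨Fin.consEquiv fun _ => ι, fun _ => rfl, fun _ _ => rfl⟩
    have he : ∀ p : ι × (Fin n → ι), ∏ j, f j (e p j) = f 0 p.1 * ∏ j : Fin n, f j.succ (p.2 j) := by
      intro p
      simp only [Fin.prod_univ_succ, he0, hes]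
    generalize hb : (fun m : Fin n → ι => ∏ j, f j.succ (m j)) = b at h1 h2
    have he' : ∀ p : ι × (Fin n → ι), ∏ j, f j (e p j) = f 0 p.1 * b p.2 := by
      intro p
      rw [he, ← hb]
    have h1' : Summable fun m => ‖b m‖ := by rw [← hb]; exact h1
    have hs : Summable fun p : ι × (Fin n → ι) => ‖∏ j, f j (e p j)‖ := by
      simp only [he']
      exact (hf 0).mul_norm h1'
    have hv : ∑' p : ι × (Fin n → ι), ∏ j, f j (e p j) = ∏ j, ∑' i, f j i := by
      simp only [he']
      rw [Fin.prod_univ_succ, ← h2.tsum_eq, tsum_mul_tsum_of_summable_norm (hf 0) h1']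
    refine ⟨e.summable_iff.1 hs, e.hasSum_iff.1 ?_⟩
    rw [← hv]
    exact hs.of_norm.hasSum

end Products

/-! ### Moments of discrete measures with Gaussian decay -/

section Moments

/-- The normalised moment `∑_m q_m ^ b / b! * g_m` of a discrete complex measure with mass `g_m` at
the node `q_m`. -/
noncomputable def moment (q g : ℤ → ℂ) (b : ℕ) : ℂ := ∑' m, q m ^ b / (b.factorial : ℂ) * g m

/-- The nodes `q` are spread out enough for all Gaussian sums over them to converge, and the
masses `g` decay like the Gaussian `exp (-A |q| ^ 2)`. -/
structure GaussianDecay (A : ℝ) (q g : ℤ → ℂ) : Prop where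
  summable : ∀ ε : ℝ, 0 < ε → Summable fun m => Real.exp (-ε * ‖q m‖ ^ 2)
  norm_le : ∀ m, ‖g m‖ ≤ Real.exp (-A * ‖q m‖ ^ 2)

theorem GaussianDecay.summable_exp {A : ℝ} (hA : 0 < A) {q g : ℤ → ℂ} (hd : GaussianDecay A q g)
    (R : ℝ) : Summable fun m => Real.exp (R * ‖q m‖) * ‖g m‖ := by
  refine Summable.of_nonneg_of_le (fun m => by positivity) (fun m => ?_)
    ((hd.summable (A / 2) (by positivity)).mul_left (Real.exp (R ^ 2 / (2 * A))))
  calc Real.exp (R * ‖q m‖) * ‖g m‖ ≤ Real.exp (R * ‖q m‖) * Real.exp (-A * ‖q m‖ ^ 2) := by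
        gcongr
        exact hd.norm_le m
    _ ≤ _ := by
        rw [← Real.exp_add, ← Real.exp_add]
        refine Real.exp_le_exp.2 ?_
        have : R ^ 2 / (2 * A) + -(A / 2) * ‖q m‖ ^ 2 - (R * ‖q m‖ + -A * ‖q m‖ ^ 2)
            = (R - A * ‖q m‖) ^ 2 / (2 * A) := by
          field_simp
          ring
        have h2 : 0 ≤ (R - A * ‖q m‖) ^ 2 / (2 * A) := by positivity
        linarith

/-- The moments are the Taylor coefficients of the two-sided Laplace transform of the measure. -/
theorem GaussianDecay.hasSum_moment {A : ℝ} (hA : 0 < A) {q g : ℤ → ℂ} (hd : GaussianDecay A q g)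
    (s : ℂ) : HasSum (fun b : ℕ => moment q g b * s ^ b) (∑' m, Complex.exp (s * q m) * g m) := by
  have hexp : ∀ z : ℂ, HasSum (fun b : ℕ => z ^ b / (b.factorial : ℂ)) (Complex.exp z) := by
    intro z
    rw [Complex.exp_eq_exp_ℂ]
    exact NormedSpace.expSeries_div_hasSum_exp z
  have hexpn : ∀ z : ℂ, HasSum (fun b : ℕ => ‖z ^ b / (b.factorial : ℂ)‖) (Real.exp ‖z‖) := by
    intro z
    rw [Real.exp_eq_exp_ℝ]
    simpa using NormedSpace.expSeries_div_hasSum_exp ‖z‖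
  let f : ℤ × ℕ → ℂ := fun p => (s * q p.1) ^ p.2 / (p.2.factorial : ℂ) * g p.1
  have hf : Summable f := by
    refine Summable.of_norm ?_
    refine (summable_prod_of_nonneg fun _ => norm_nonneg _).2 ⟨fun m => ?_, ?_⟩
    · simp only [f, norm_mul (_ / _)]
      exact (hexpn _).summable.mul_right _
    · simp only [f, norm_mul (_ / _), tsum_mul_right, (hexpn _).tsum_eq, norm_mul s]
      exact hd.summable_exp hA _
  have h1 : ∑' p, f p = ∑' m, Complex.exp (s * q m) * g m := by
    rw [hf.tsum_prod]
    congr 1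
    ext m
    simp only [f, tsum_mul_right, (hexp _).tsum_eq]
  have hf' : Summable (f ∘ Equiv.prodComm ℕ ℤ) := (Equiv.prodComm ℕ ℤ).summable_iff.2 hf
  have h2 : HasSum (f ∘ Equiv.prodComm ℕ ℤ) (∑' m, Complex.exp (s * q m) * g m) := by
    rw [Equiv.hasSum_iff, ← h1]
    exact hf.hasSum
  have h3 := h2.prod_fiberwise fun b => (hf'.prod_factor b).hasSum
  convert! h3 using 2 with b
  rw [moment, ← tsum_mul_right]
  congr 1
  ext m
  simp only [f, Function.comp_apply, Equiv.prodComm_apply, Prod.swap, mul_pow]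
  ring

theorem GaussianDecay.summable_moment {A : ℝ} (hA : 0 < A) {q g : ℤ → ℂ}
    (hd : GaussianDecay A q g) (b : ℕ) :
    Summable fun m => ‖q m ^ b / (b.factorial : ℂ) * g m‖ := by
  refine Summable.of_nonneg_of_le (fun m => norm_nonneg _) (fun m => ?_) (hd.summable_exp hA 1)
  rw [norm_mul, norm_div, norm_pow, Complex.norm_natCast, one_mul]
  gcongr
  exact Real.pow_div_factorial_le_exp _ (norm_nonneg _) b

/-- The Taylor coefficients of `exp (c s ^ 2)`. -/
noncomputable def gaussCoeff (c : ℂ) (i : ℕ) : ℂ :=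
  if Even i then c ^ (i / 2) / ((i / 2).factorial : ℂ) else 0

theorem hasSum_gaussCoeff (c s : ℂ) :
    HasSum (fun i : ℕ => gaussCoeff c i * s ^ i) (Complex.exp (c * s ^ 2)) := by
  have hinj : Function.Injective fun k : ℕ => 2 * k := fun a b h => by simpa using h
  rw [← hinj.hasSum_iff]
  · rw [Complex.exp_eq_exp_ℂ]
    convert! NormedSpace.expSeries_div_hasSum_exp (c * s ^ 2) using 2 with k
    simp only [Function.comp_apply, gaussCoeff, even_two_mul, if_true, mul_pow, pow_mul]
    rw [Nat.mul_div_cancel_left k two_pos]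
    ring
  · intro i hi
    have : ¬ Even i := fun ⟨k, hk⟩ => hi ⟨k, by simp only [hk]; ring⟩
    simp [gaussCoeff, this]

theorem powerSeries_coeff_unique {a b : ℕ → ℂ} {f : ℂ → ℂ}
    (ha : ∀ s, HasSum (fun k => a k * s ^ k) (f s))
    (hb : ∀ s, HasSum (fun k => b k * s ^ k) (f s)) : a = b := by
  have key : ∀ {a : ℕ → ℂ}, (∀ s, HasSum (fun k => a k * s ^ k) (f s)) →
      HasFPowerSeriesAt f (FormalMultilinearSeries.ofScalars ℂ a) 0 := by
    intro a ha
    refine hasFPowerSeriesAt_iff.2 (Eventually.of_forall fun s => ?_)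
    simpa [FormalMultilinearSeries.coeff_ofScalars, mul_comm] using ha s
  have := (key ha).eq_formalMultilinearSeries (key hb)
  ext k
  simpa [FormalMultilinearSeries.coeff_ofScalars] using congrArg (fun p => p.coeff k) this

/-- Multiplying a power series by `exp (c s ^ 2)` convolves the coefficients with
`gaussCoeff c`. -/
theorem coeff_eq_of_eq_exp_mul {a b : ℕ → ℂ} {f g : ℂ → ℂ} (c : ℂ)
    (ha : ∀ s, HasSum (fun k => a k * s ^ k) (f s))
    (hb : ∀ s, HasSum (fun k => b k * s ^ k) (g s))
    (h : ∀ s, f s = Complex.exp (c * s ^ 2) * g s) (k : ℕ) :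
    a k = ∑ i ∈ Finset.Iic k, gaussCoeff c (k - i) * b i := by
  have h1 : ∀ s, HasSum
      (fun k => (∑ i ∈ Finset.Iic k, gaussCoeff c (k - i) * b i) * s ^ k) (f s) := by
    intro s
    rw [h s, mul_comm]
    have := hasSum_sum_range_mul_of_summable_norm (hb s).summable.norm
      (hasSum_gaussCoeff c s).summable.norm
    rw [(hb s).tsum_eq, (hasSum_gaussCoeff c s).tsum_eq] at this
    convert! this using 2 with k
    rw [Finset.sum_mul, show Finset.Iic k = Finset.range (k + 1) by
      ext i; simp]
    refine Finset.sum_congr rfl fun i hi => ?_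
    rw [Finset.mem_range, Nat.lt_succ_iff] at hi
    have hk : s ^ k = s ^ (k - i) * s ^ i := by rw [← pow_add, Nat.sub_add_cancel hi]
    rw [hk]
    ring
  exact congrFun (powerSeries_coeff_unique ha h1) k

theorem pow_div_factorial_le {ε r : ℝ} (hε : 0 < ε) (hr : 0 ≤ r) (b : ℕ) :
    r ^ b / b.factorial ≤ (√(2 * ε))⁻¹ ^ b / √b.factorial * Real.exp (ε * r ^ 2) := by
  have h2ε : 0 < √(2 * ε) := by positivity
  have hsq : √(2 * ε) ^ 2 = 2 * ε := Real.sq_sqrt (by positivity)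
  have hfac : 0 < √(b.factorial : ℝ) := Real.sqrt_pos.2 (by positivity)
  have hfs : √(b.factorial : ℝ) * √(b.factorial : ℝ) = b.factorial :=
    Real.mul_self_sqrt (by positivity)
  set t := √(2 * ε) * r with ht
  have ht0 : 0 ≤ t := by positivity
  -- the square of this inequality is a term of the exponential series of `t ^ 2`
  have h1 : t ^ b / √(b.factorial : ℝ) ≤ Real.exp (ε * r ^ 2) := by
    refine le_of_sq_le_sq ?_ (Real.exp_pos _).le
    rw [div_pow, Real.sq_sqrt (by positivity), ← pow_mul, mul_comm b 2, pow_mul,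
      ← Real.exp_nat_mul]
    refine (Real.pow_div_factorial_le_exp (t ^ 2) (by positivity) b).trans (le_of_eq ?_)
    rw [ht, mul_pow, hsq]
    push_cast
    ring_nf
  have hr' : r = (√(2 * ε))⁻¹ * t := by
    rw [ht]; field_simp
  calc r ^ b / b.factorial = (√(2 * ε))⁻¹ ^ b / √b.factorial * (t ^ b / √b.factorial) := by
        rw [div_mul_div_comm, ← mul_pow, ← hr', hfs]
    _ ≤ _ := by gcongr

end Moments

/-! ### Pairing of entire functions with product measures -/

section Multi

variable {n : ℕ}

/-- Absolute convergence for all `y` of `∑ d_β y ^ β / √β!`. -/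
def SqrtFactorialSummable (d : (Fin n → ℕ) → ℂ) : Prop :=
  ∀ Y : ℝ, 0 ≤ Y → Summable fun β => ‖d β‖ * ∏ j, (Y ^ β j / √(β j).factorial)

theorem norm_mul_prod_le (d : (Fin n → ℕ) → ℂ) {ε : ℝ} (hε : 0 < ε) (z : Fin n → ℂ)
    (β : Fin n → ℕ) :
    ‖d β * ∏ j, (z j ^ β j / ((β j).factorial : ℂ))‖ ≤
      (‖d β‖ * ∏ j, ((√(2 * ε))⁻¹ ^ β j / √(β j).factorial)) *
        ∏ j, Real.exp (ε * ‖z j‖ ^ 2) := by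
  rw [norm_mul, norm_prod, mul_assoc, ← Finset.prod_mul_distrib]
  gcongr with j
  rw [norm_div, norm_pow, Complex.norm_natCast]
  exact pow_div_factorial_le hε (norm_nonneg _) _

/-- The double series obtained by integrating the power series of an entire function, with
sub-Gaussian growth, against a product of discrete measures with Gaussian decay. -/
theorem summable_norm_double {d : (Fin n → ℕ) → ℂ} (hd : SqrtFactorialSummable d) {A : ℝ}
    (hA : 0 < A) {q g : Fin n → ℤ → ℂ} (hq : ∀ j, GaussianDecay A (q j) (g j)) :
    Summable fun p : (Fin n → ℤ) × (Fin n → ℕ) =>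
      ‖d p.2 * ∏ j, (q j (p.1 j) ^ p.2 j / ((p.2 j).factorial : ℂ) * g j (p.1 j))‖ := by
  have h1 := (hasSum_prod_pi (fun j m => ((Real.exp (-(A / 2) * ‖q j m‖ ^ 2) : ℝ) : ℂ))
    fun j => by
      simpa only [Complex.norm_real, Real.norm_eq_abs, Real.abs_exp]
        using (hq j).summable (A / 2) (by positivity)).1
  have h2 := hd (√(2 * (A / 2)))⁻¹ (by positivity)
  refine Summable.of_nonneg_of_le (fun p => norm_nonneg _) (fun p => ?_)
    (h1.mul_of_nonneg h2 (fun _ => norm_nonneg _) fun _ => by positivity)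
  rw [Finset.prod_mul_distrib, ← mul_assoc, norm_mul]
  refine (mul_le_mul_of_nonneg_right (norm_mul_prod_le d (ε := A / 2) (by positivity) _ _)
    (norm_nonneg _)).trans ?_
  rw [mul_assoc, mul_comm]
  refine mul_le_mul_of_nonneg_right ?_ (by positivity)
  rw [norm_prod, norm_prod, ← Finset.prod_mul_distrib]
  refine Finset.prod_le_prod (fun j _ => by positivity) fun j _ => ?_
  rw [Complex.norm_real, Real.norm_eq_abs, Real.abs_exp]
  calc Real.exp (A / 2 * ‖q j (p.1 j)‖ ^ 2) * ‖g j (p.1 j)‖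
      ≤ Real.exp (A / 2 * ‖q j (p.1 j)‖ ^ 2) * Real.exp (-A * ‖q j (p.1 j)‖ ^ 2) := by
        gcongr
        exact (hq j).norm_le _
    _ = _ := by
        rw [← Real.exp_add]
        ring_nf

theorem mul_prod_div_factorial (d : (Fin n → ℕ) → ℂ) (z : Fin n → ℂ) (β : Fin n → ℕ) :
    d β * ∏ j, (z j ^ β j / ((β j).factorial : ℂ))
      = d β / (multiFactorial β : ℂ) * ∏ j, z j ^ β j := by
  rw [Finset.prod_div_distrib, multiFactorial]
  push_cast
  ring

theorem SqrtFactorialSummable.summable_pow {d : (Fin n → ℕ) → ℂ} (hd : SqrtFactorialSummable d)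
    (r : ℝ) (hr : 0 ≤ r) :
    Summable fun β => ‖d β / (multiFactorial β : ℂ)‖ * r ^ ∑ j, β j := by
  refine Summable.of_nonneg_of_le (fun β => by positivity) (fun β => ?_)
    ((hd (√(2 * 1))⁻¹ (by positivity)).mul_right (∏ _j : Fin n, Real.exp (1 * r ^ 2)))
  have h1 := norm_mul_prod_le d one_pos (fun _ => (r : ℂ)) β
  rw [mul_prod_div_factorial, norm_mul, Finset.prod_pow_eq_pow_sum, norm_pow,
    Complex.norm_real, Real.norm_of_nonneg hr] at h1
  exact h1

theorem summable_norm_multiSeries {d : (Fin n → ℕ) → ℂ} (hd : SqrtFactorialSummable d) {A : ℝ}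
    (hA : 0 < A) {q g : Fin n → ℤ → ℂ} (hq : ∀ j, GaussianDecay A (q j) (g j)) :
    Summable fun m : Fin n → ℤ =>
      ‖multiSeries (fun β => d β / (multiFactorial β : ℂ)) (fun j => q j (m j))
        * ∏ j, g j (m j)‖ := by
  have h := summable_norm_double hd hA hq
  refine Summable.of_nonneg_of_le (fun m => norm_nonneg _) (fun m => ?_) h.prod
  rw [multiSeries, ← tsum_mul_right]
  refine (norm_tsum_le_tsum_norm ?_).trans (le_of_eq ?_)
  · convert! h.prod_factor m using 3 with β
    rw [← mul_prod_div_factorial, Finset.prod_mul_distrib, mul_assoc]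
  · congr 1
    ext β
    rw [← mul_prod_div_factorial, Finset.prod_mul_distrib, mul_assoc]

/-- Interchange of summation: integrating an entire function against a product measure pairs its
Taylor coefficients with the moments. -/
theorem hasSum_multiSeries_moment {d : (Fin n → ℕ) → ℂ} (hd : SqrtFactorialSummable d) {A : ℝ}
    (hA : 0 < A) {q g : Fin n → ℤ → ℂ} (hq : ∀ j, GaussianDecay A (q j) (g j)) :
    HasSum (fun β => d β * ∏ j, moment (q j) (g j) (β j))
      (∑' m : Fin n → ℤ, multiSeries (fun β => d β / (multiFactorial β : ℂ))
        (fun j => q j (m j)) * ∏ j, g j (m j)) := by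
  let f : (Fin n → ℤ) × (Fin n → ℕ) → ℂ := fun p =>
    d p.2 * ∏ j, (q j (p.1 j) ^ p.2 j / ((p.2 j).factorial : ℂ) * g j (p.1 j))
  have hf : Summable f := (summable_norm_double hd hA hq).of_norm
  have h1 : ∑' p, f p = ∑' m : Fin n → ℤ, multiSeries (fun β => d β / (multiFactorial β : ℂ))
        (fun j => q j (m j)) * ∏ j, g j (m j) := by
    rw [hf.tsum_prod]
    congr 1
    ext m
    rw [multiSeries, ← tsum_mul_right]
    congr 1
    ext β
    rw [← mul_prod_div_factorial, mul_assoc, ← Finset.prod_mul_distrib]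
  have hf' : Summable (f ∘ Equiv.prodComm (Fin n → ℕ) (Fin n → ℤ)) :=
    (Equiv.prodComm _ _).summable_iff.2 hf
  have h2 : HasSum (f ∘ Equiv.prodComm (Fin n → ℕ) (Fin n → ℤ)) (∑' p, f p) := by
    rw [Equiv.hasSum_iff]
    exact hf.hasSum
  rw [← h1]
  have h3 := h2.prod_fiberwise fun b => (hf'.prod_factor b).hasSum
  convert! h3 using 2 with β
  have h4 := (hasSum_prod_pi (fun j m => q j m ^ β j / ((β j).factorial : ℂ) * g j m)
    fun j => (hq j).summable_moment hA (β j)).2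
  simp only [f, Function.comp_apply, Equiv.prodComm_apply, Prod.swap, tsum_mul_left]
  rw [h4.tsum_eq]
  rfl

end Multi

/-! ### Poisson summation for the Gaussian -/

section Theta

/-- The displacement `h m - x` of the grid point `h m` from `x`. -/
noncomputable def gridNode (h x : ℝ) (m : ℤ) : ℂ := ((h * m - x : ℝ) : ℂ)

/-- The Gaussian weight `exp (-(h m - x) ^ 2 / (h ^ 2 D))`. -/
noncomputable def gridMass (h D x : ℝ) (m : ℤ) : ℂ :=
  ((Real.exp (-(h * m - x) ^ 2 / (h ^ 2 * D)) : ℝ) : ℂ)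

/-- The imaginary displacement `π i h D m` attached to the dual lattice point `m / h`. -/
noncomputable def dualNode (h D : ℝ) (m : ℤ) : ℂ := Real.pi * Complex.I * h * D * m

/-- The Fourier weight `exp (-π ^ 2 D m ^ 2) exp (2 π i m x / h)`. -/
noncomputable def dualMass (h D x : ℝ) (m : ℤ) : ℂ :=
  Complex.exp (-(Real.pi : ℂ) ^ 2 * D * (m : ℂ) ^ 2) *
    Complex.exp (2 * Real.pi * Complex.I * ((m : ℂ) * x) / h)

theorem summable_exp_neg_mul_sq {a t : ℝ} (ha : 0 < a) :
    Summable fun m : ℤ => Real.exp (-a * ((m : ℝ) - t) ^ 2) := by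
  let τ : ℂ := ((a / Real.pi : ℝ) : ℂ) * Complex.I
  let z : ℂ := ((-(a * t) / Real.pi : ℝ) : ℂ) * Complex.I
  have hτ : τ.im = a / Real.pi := by simp [τ]
  have hz : z.im = -(a * t) / Real.pi := by simp [z]
  have h1 := ((summable_jacobiTheta₂_term_iff z τ).2 (by rw [hτ]; positivity)).norm.mul_left
    (Real.exp (-a * t ^ 2))
  convert! h1 using 2 with m
  rw [norm_jacobiTheta₂_term, ← Real.exp_add, hτ, hz]
  congr 1
  have := Real.pi_ne_zero
  field_simp
  ring

variable {h D : ℝ}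

theorem gaussianDecay_grid (hh : 0 < h) (x : ℝ) :
    GaussianDecay (1 / (h ^ 2 * D)) (gridNode h x) (gridMass h D x) where
  summable ε hε := by
    have := summable_exp_neg_mul_sq (a := ε * h ^ 2) (t := x / h) (by positivity)
    convert! this using 3 with m
    rw [gridNode, Complex.norm_real, Real.norm_eq_abs, sq_abs]
    field_simp
  norm_le m := by
    rw [gridMass, gridNode, Complex.norm_real, Complex.norm_real, Real.norm_eq_abs,
      Real.norm_eq_abs, sq_abs, Real.abs_exp]
    apply le_of_eq
    congr 1
    ring

theorem norm_dualNode (hh : 0 < h) (hD : 0 < D) (m : ℤ) :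
    ‖dualNode h D m‖ = Real.pi * h * D * |(m : ℝ)| := by
  rw [dualNode, norm_mul, norm_mul, norm_mul, norm_mul]
  simp [abs_of_pos hh, abs_of_pos hD, abs_of_pos Real.pi_pos]

theorem gaussianDecay_dual (hh : 0 < h) (hD : 0 < D) (x : ℝ) :
    GaussianDecay (1 / (h ^ 2 * D)) (dualNode h D) (dualMass h D x) where
  summable ε hε := by
    have := summable_exp_neg_mul_sq (a := ε * (Real.pi * h * D) ^ 2) (t := 0)
      (by have := Real.pi_pos; positivity)
    convert! this using 3 with m
    rw [norm_dualNode hh hD, mul_pow, sq_abs]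
    ring
  norm_le m := by
    have e1 : -(Real.pi : ℂ) ^ 2 * D * (m : ℂ) ^ 2
        = ((-Real.pi ^ 2 * D * (m : ℝ) ^ 2 : ℝ) : ℂ) := by push_cast; ring
    have e2 : 2 * Real.pi * Complex.I * ((m : ℂ) * x) / h
        = ((2 * Real.pi * (m * x) / h : ℝ) : ℂ) * Complex.I := by push_cast; ring
    rw [dualMass, norm_mul, e1, e2, Complex.norm_exp_ofReal_mul_I, mul_one, Complex.norm_exp,
      Complex.ofReal_re, norm_dualNode hh hD, mul_pow, sq_abs]
    apply le_of_eq
    congr 1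
    field_simp

/-- Poisson summation for the Gaussian: the Laplace transforms of the grid measure and of the dual
measure differ by the factor `exp (h ^ 2 D s ^ 2 / 4)`. -/
theorem tsum_grid_eq_tsum_dual (hh : 0 < h) (hD : 0 < D) (x : ℝ) (s : ℂ) :
    (((Real.pi * D) ^ (-1 / 2 : ℝ) : ℝ) : ℂ) *
        ∑' m, Complex.exp (s * gridNode h x m) * gridMass h D x m
      = Complex.exp (((h ^ 2 * D / 4 : ℝ) : ℂ) * s ^ 2) *
        ∑' m, Complex.exp (s * dualNode h D m) * dualMass h D x m := by
  have hπ : (Real.pi : ℂ) ≠ 0 := by exact_mod_cast Real.pi_ne_zero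
  have hh' : (h : ℂ) ≠ 0 := by exact_mod_cast hh.ne'
  have hD' : (D : ℂ) ≠ 0 := by exact_mod_cast hD.ne'
  have hI : Complex.I ^ 2 = -1 := Complex.I_sq
  have hpos : 0 < Real.pi * D := mul_pos Real.pi_pos hD
  have key := Complex.tsum_exp_neg_quadratic (a := ((Real.pi * D : ℝ) : ℂ))
    (by rwa [Complex.ofReal_re]) (Complex.I * (s * h * D / 2 + x / h))
  have hC : 1 / ((Real.pi * D : ℝ) : ℂ) ^ (1 / 2 : ℂ)
      = (((Real.pi * D) ^ (-1 / 2 : ℝ) : ℝ) : ℂ) := by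
    rw [neg_div, Real.rpow_neg hpos.le, Complex.ofReal_inv, Complex.ofReal_cpow hpos.le, one_div]
    norm_num
  have h1 : ∀ m : ℤ, Complex.exp (s * dualNode h D m) * dualMass h D x m
      = Complex.exp (-(Real.pi : ℂ) * ((Real.pi * D : ℝ) : ℂ) * (m : ℂ) ^ 2
        + 2 * Real.pi * (Complex.I * (s * h * D / 2 + x / h)) * m) := by
    intro m
    rw [dualMass, dualNode, ← Complex.exp_add, ← Complex.exp_add]
    congr 1
    push_cast
    field_simp
    ring
  have h2 : ∀ m : ℤ, Complex.exp (-(Real.pi : ℂ) / ((Real.pi * D : ℝ) : ℂ) *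
        ((m : ℂ) + Complex.I * (Complex.I * (s * h * D / 2 + x / h))) ^ 2)
      = Complex.exp (-(((h ^ 2 * D / 4 : ℝ) : ℂ) * s ^ 2)) *
        (Complex.exp (s * gridNode h x m) * gridMass h D x m) := by
    intro m
    rw [gridMass, gridNode, Complex.ofReal_exp, ← Complex.exp_add, ← Complex.exp_add]
    congr 1
    rw [← mul_assoc Complex.I Complex.I, Complex.I_mul_I]
    push_cast
    field_simp
    ring
  simp only [h1, key, h2, tsum_mul_left, hC]
  rw [mul_left_comm (Complex.exp (((h ^ 2 * D / 4 : ℝ) : ℂ) * s ^ 2)),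
    ← mul_assoc (Complex.exp (((h ^ 2 * D / 4 : ℝ) : ℂ) * s ^ 2)), ← Complex.exp_add]
  simp

theorem hasSum_grid (hh : 0 < h) (hD : 0 < D) (x : ℝ) (s : ℂ) :
    HasSum (fun k => (((Real.pi * D) ^ (-1 / 2 : ℝ) : ℝ) : ℂ) *
        moment (gridNode h x) (gridMass h D x) k * s ^ k)
      ((((Real.pi * D) ^ (-1 / 2 : ℝ) : ℝ) : ℂ) *
        ∑' m, Complex.exp (s * gridNode h x m) * gridMass h D x m) := by
  simp only [mul_assoc]
  exact ((gaussianDecay_grid hh x).hasSum_moment (by positivity) s).mul_left _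

theorem moment_grid_eq (hh : 0 < h) (hD : 0 < D) (x : ℝ) (k : ℕ) :
    (((Real.pi * D) ^ (-1 / 2 : ℝ) : ℝ) : ℂ) * moment (gridNode h x) (gridMass h D x) k
      = ∑ i ∈ Finset.Iic k, gaussCoeff ((h ^ 2 * D / 4 : ℝ) : ℂ) (k - i) *
        moment (dualNode h D) (dualMass h D x) i :=
  coeff_eq_of_eq_exp_mul _ (hasSum_grid hh hD x)
    (fun s => (gaussianDecay_dual hh hD x).hasSum_moment (by positivity) s)
    (tsum_grid_eq_tsum_dual hh hD x) k

theorem moment_dual_eq (hh : 0 < h) (hD : 0 < D) (x : ℝ) (k : ℕ) :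
    moment (dualNode h D) (dualMass h D x) k
      = ∑ i ∈ Finset.Iic k, gaussCoeff (-((h ^ 2 * D / 4 : ℝ) : ℂ)) (k - i) *
        ((((Real.pi * D) ^ (-1 / 2 : ℝ) : ℝ) : ℂ) *
          moment (gridNode h x) (gridMass h D x) i) := by
  refine coeff_eq_of_eq_exp_mul _
    (fun s => (gaussianDecay_dual hh hD x).hasSum_moment (by positivity) s)
    (hasSum_grid hh hD x) (fun s => ?_) k
  rw [tsum_grid_eq_tsum_dual hh hD x, ← mul_assoc, ← Complex.exp_add]
  simp

end Theta

/-! ### Taylor coefficients of harmonic functions -/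

section HarmonicCoefficients

variable {n : ℕ}

theorem mul_gaussCoeff_add_two (c : ℂ) (i : ℕ) :
    ((i + 2 : ℕ) : ℂ) * gaussCoeff c (i + 2) = 2 * c * gaussCoeff c i := by
  have he : Even (i + 2) ↔ Even i := by simp [Nat.even_add]
  simp only [gaussCoeff, he]
  by_cases hi : Even i
  · obtain ⟨k, rfl⟩ := hi
    rw [← two_mul, if_pos (even_two_mul k), if_pos (even_two_mul k),
      show (2 * k + 2) / 2 = k + 1 by omega, show 2 * k / 2 = k by omega, Nat.factorial_succ]
    have h1 : (k.factorial : ℂ) ≠ 0 := by exact_mod_cast (Nat.factorial_pos k).ne'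
    have h2 : (k : ℂ) + 1 ≠ 0 := by exact_mod_cast Nat.succ_ne_zero k
    push_cast
    field_simp
    ring
  · simp [hi]

theorem gaussCoeff_zero (c : ℂ) : gaussCoeff c 0 = 1 := by simp [gaussCoeff]

theorem gaussCoeff_one (c : ℂ) : gaussCoeff c 1 = 0 := by simp [gaussCoeff]

theorem prod_apply_eq_mul_erase (f : ℕ → ℂ) (γ : Fin n → ℕ) (j : Fin n) :
    ∏ i, f (γ i) = f (γ j) * ∏ i ∈ Finset.univ.erase j, f (γ i) :=
  (Finset.mul_prod_erase _ (fun i => f (γ i)) (Finset.mem_univ j)).symm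

/-- The part of positive order of `exp (c Δ)` annihilates a harmonic function: by the Euler
identity for the coefficients of `exp (c |X| ^ 2)`, the sum of order `g` is, up to the factor `g`,
a combination of the relations `hd`. -/
theorem sum_gaussCoeff_eq_zero {d : (Fin n → ℕ) → ℂ}
    (hd : ∀ β : Fin n → ℕ, ∑ j, d (β + Pi.single j 1 + Pi.single j 1) = 0) (c : ℂ) (η : Fin n → ℕ) (g : ℕ) :
    ∑ γ ∈ Finset.piAntidiag Finset.univ (g + 1), (∏ j, gaussCoeff c (γ j)) * d (η + γ) = 0 := by
  let f : (Fin n → ℕ) → Fin n → ℂ := fun γ j =>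
    (γ j : ℂ) * ((∏ i, gaussCoeff c (γ i)) * d (η + γ))
  have h1 : ∑ γ ∈ Finset.piAntidiag Finset.univ (g + 1), ∑ j, f γ j
      = ((g + 1 : ℕ) : ℂ) * ∑ γ ∈ Finset.piAntidiag Finset.univ (g + 1),
        (∏ j, gaussCoeff c (γ j)) * d (η + γ) := by
    rw [Finset.mul_sum]
    refine Finset.sum_congr rfl fun γ hγ => ?_
    simp only [f]
    rw [← Finset.sum_mul, ← (Finset.mem_piAntidiag.1 hγ).1]
    push_cast
    rfl
  have hf0 : ∀ γ j, γ j = 0 → f γ j = 0 := by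
    intro γ j h0
    simp [f, h0]
  have hf1 : ∀ (γ : Fin n → ℕ) j, γ j = 0 → f (γ + Pi.single j 1) j = 0 := by
    intro γ j h0
    have : ∏ i, gaussCoeff c ((γ + Pi.single j 1 : Fin n → ℕ) i) = 0 :=
      Finset.prod_eq_zero (Finset.mem_univ j) (by simp [h0, gaussCoeff_one])
    simp only [f]
    rw [this, zero_mul, mul_zero]
  have hf2 : ∀ (γ : Fin n → ℕ) j, f (γ + Pi.single j 1 + Pi.single j 1) j
      = 2 * c * ((∏ i, gaussCoeff c (γ i)) * d (η + γ + Pi.single j 1 + Pi.single j 1)) := by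
    intro γ j
    have hj : (γ + Pi.single j 1 + Pi.single j 1 : Fin n → ℕ) j = γ j + 2 := by simp
    have he : ∏ i ∈ Finset.univ.erase j,
        gaussCoeff c ((γ + Pi.single j 1 + Pi.single j 1 : Fin n → ℕ) i)
        = ∏ i ∈ Finset.univ.erase j, gaussCoeff c (γ i) := by
      refine Finset.prod_congr rfl fun i hi => ?_
      simp [(Finset.mem_erase.1 hi).1]
    simp only [f]
    rw [prod_apply_eq_mul_erase _ _ j, prod_apply_eq_mul_erase _ γ j, he, hj, ← mul_assoc,
      ← mul_assoc, mul_gaussCoeff_add_two]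
    simp only [add_assoc]
    ring
  have h2 : ∑ γ ∈ Finset.piAntidiag Finset.univ (g + 1), ∑ j, f γ j = 0 := by
    rw [sum_piAntidiag_succ g f hf0]
    cases g with
    | zero =>
      refine Finset.sum_eq_zero fun γ hγ => Finset.sum_eq_zero fun j _ => hf1 γ j ?_
      have := (Finset.mem_piAntidiag.1 hγ).1
      simp_all
    | succ g =>
      rw [sum_piAntidiag_succ g (fun γ j => f (γ + Pi.single j 1) j) hf1]
      refine Finset.sum_eq_zero fun γ _ => ?_
      simp only [hf2]
      rw [← Finset.mul_sum, ← Finset.mul_sum, hd (η + γ)]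
      simp
  rw [h1] at h2
  exact (mul_eq_zero.1 h2).resolve_left (by exact_mod_cast Nat.succ_ne_zero g)

theorem sum_filter_le_gaussCoeff {d : (Fin n → ℕ) → ℂ}
    (hd : ∀ β : Fin n → ℕ, ∑ j, d (β + Pi.single j 1 + Pi.single j 1) = 0) (c : ℂ) (k : ℕ) (α : Fin n → ℕ) :
    ∑ β ∈ (Finset.piAntidiag Finset.univ k).filter (fun β => ∀ j, α j ≤ β j),
        d β * ∏ j, gaussCoeff c (β j - α j)
      = if ∑ j, α j = k then d α else 0 := by
  rcases lt_or_ge k (∑ j, α j) with hlt | hle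
  · rw [if_neg hlt.ne', Finset.sum_eq_zero]
    intro β hβ
    simp only [Finset.mem_filter, Finset.mem_piAntidiag] at hβ
    have h1 := Finset.sum_le_sum fun j (_ : j ∈ Finset.univ) => hβ.2 j
    have h2 : ∑ j, β j = k := hβ.1.1
    omega
  · obtain ⟨g, rfl⟩ := Nat.exists_eq_add_of_le hle
    have h1 : ∑ β ∈ (Finset.piAntidiag Finset.univ (∑ j, α j + g)).filter (fun β => ∀ j, α j ≤ β j),
          d β * ∏ j, gaussCoeff c (β j - α j)
        = ∑ γ ∈ Finset.piAntidiag Finset.univ g, (∏ j, gaussCoeff c (γ j)) * d (α + γ) := by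
      symm
      refine Finset.sum_nbij' (fun γ => α + γ) (fun β => β - α) ?_ ?_ ?_ ?_ ?_
      · intro γ hγ
        simp_all [Finset.sum_add_distrib]
      · intro β hβ
        simp only [Finset.mem_filter, Finset.mem_piAntidiag] at hβ ⊢
        refine ⟨?_, by simp⟩
        simp only [Pi.sub_apply]
        rw [Finset.sum_tsub_distrib _ fun i _ => hβ.2 i, hβ.1.1]
        simp
      · intro γ _
        simp
      · intro β hβ
        exact add_tsub_cancel_of_le (Finset.mem_filter.1 hβ).2
      · intro γ _
        simp [mul_comm]
    rw [h1]
    cases g with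
    | zero => simp [gaussCoeff_zero]
    | succ g => rw [sum_gaussCoeff_eq_zero hd, if_neg (by omega)]

/-- Convolving with the coefficients of `exp (c |X| ^ 2)` does not change the homogeneous parts of a
harmonic power series. -/
theorem sum_mul_convolution_gaussCoeff {d : (Fin n → ℕ) → ℂ}
    (hd : ∀ β : Fin n → ℕ, ∑ j, d (β + Pi.single j 1 + Pi.single j 1) = 0) (c : ℂ) (B : (Fin n → ℕ) → ℂ)
    (k : ℕ) :
    ∑ β ∈ Finset.piAntidiag Finset.univ k,
        d β * ∑ α ∈ Finset.Iic β, (∏ j, gaussCoeff c (β j - α j)) * B α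
      = ∑ β ∈ Finset.piAntidiag Finset.univ k, d β * B β := by
  simp only [Finset.mul_sum]
  rw [Finset.sum_comm' (t' := Finset.Iic fun _ => k)
    (s' := fun α => (Finset.piAntidiag Finset.univ k).filter (fun β => ∀ j, α j ≤ β j))]
  · have h1 : ∀ α, ∑ β ∈ (Finset.piAntidiag Finset.univ k).filter (fun β => ∀ j, α j ≤ β j),
        d β * ((∏ j, gaussCoeff c (β j - α j)) * B α)
        = if ∑ j, α j = k then d α * B α else 0 := by
      intro α
      simp only [← mul_assoc]
      rw [← Finset.sum_mul, sum_filter_le_gaussCoeff hd, ite_mul, zero_mul]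
    simp only [h1]
    rw [← Finset.sum_filter]
    refine Finset.sum_congr ?_ fun _ _ => rfl
    ext α
    simp only [Finset.mem_filter, Finset.mem_Iic, Finset.mem_piAntidiag, Finset.mem_univ, Pi.le_def,
      implies_true, and_true, and_iff_right_iff_imp]
    rintro rfl j
    exact Finset.single_le_sum (fun _ _ => Nat.zero_le _) (Finset.mem_univ j)
  · intro β α
    simp only [Finset.mem_filter, Finset.mem_Iic, Finset.mem_piAntidiag, Finset.mem_univ, Pi.le_def,
      implies_true, and_true]
    constructor
    · rintro ⟨rfl, hle⟩
      exact ⟨⟨rfl, hle⟩, fun j => (hle j).trans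
        (Finset.single_le_sum (fun _ _ => Nat.zero_le _) (Finset.mem_univ j))⟩
    · rintro ⟨⟨hk, hle⟩, -⟩
      exact ⟨hk, hle⟩

theorem Iic_eq_piFinset (β : Fin n → ℕ) :
    Finset.Iic β = Fintype.piFinset fun j => Finset.Iic (β j) := by
  ext α
  simp [Pi.le_def]

theorem prod_sum_Iic (β : Fin n → ℕ) (f : Fin n → ℕ → ℂ) :
    ∏ j, ∑ i ∈ Finset.Iic (β j), f j i = ∑ α ∈ Finset.Iic β, ∏ j, f j (α j) := by
  rw [Finset.prod_univ_sum, Iic_eq_piFinset]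

end HarmonicCoefficients

/-! ### The lattice sums in the saturation error -/

section Assembly

variable {n : ℕ}

/-- `coeffA` is a product over the coordinates of the Taylor coefficients of `exp (-t ^ 2 / 4)`. -/
theorem coeffA_eq_prod (γ : Fin n → ℕ) :
    coeffA γ = ∏ j, (if Even (γ j) then
      (-1) ^ (γ j / 2) / (((γ j / 2).factorial : ℝ) * 4 ^ (γ j / 2)) else 0) := by
  rw [coeffA]
  split_ifs with h
  · simp only [if_pos (h _), multiOrder, multiFactorial]
    rw [Finset.prod_div_distrib, Finset.prod_mul_distrib, Finset.prod_pow_eq_pow_sum,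
      Finset.prod_pow_eq_pow_sum]
    push_cast
    rfl
  · push Not at h
    obtain ⟨j, hj⟩ := h
    exact (Finset.prod_eq_zero (Finset.mem_univ j) (if_neg hj)).symm

variable {h D : ℝ}

theorem rpow_neg_half_eq_prod (hD : 0 < D) :
    (((Real.pi * D) ^ (-(n : ℝ) / 2) : ℝ) : ℂ)
      = ∏ _j : Fin n, (((Real.pi * D) ^ (-1 / 2 : ℝ) : ℝ) : ℂ) := by
  rw [Finset.prod_const, Finset.card_univ, Fintype.card_fin, ← Complex.ofReal_pow,
    ← Real.rpow_natCast, ← Real.rpow_mul (mul_pos Real.pi_pos hD).le]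
  congr 2
  ring

theorem gaussianWeight_eq_prod (x : EuclideanSpace ℝ (Fin n))
    (m : Fin n → ℤ) : (gaussianWeight h D x m : ℂ) = ∏ j, gridMass h D (x j) (m j) := by
  simp only [gaussianWeight, gridMass]
  rw [← Complex.ofReal_prod, ← Real.exp_sum, EuclideanSpace.norm_sq_eq, ← Finset.sum_div,
    Finset.sum_neg_distrib]
  congr 5
  ext j
  rw [Real.norm_eq_abs, sq_abs]
  simp only [gridPoint, PiLp.sub_apply]
  ring

/-- Scaling of one Hermite term: `(-h √D) ^ b` turns the coefficients of `exp (-t ^ 2 / 4)` into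
those of `exp (-h ^ 2 D s ^ 2 / 4)`. -/
theorem scaled_coeff_eq (hh : 0 < h) (hD : 0 < D) (x : ℝ) (m : ℤ) {i b : ℕ} (hi : i ≤ b) :
    (((-(h * √D)) ^ b * ((if Even (b - i) then
      (-1) ^ ((b - i) / 2) / ((((b - i) / 2).factorial : ℝ) * 4 ^ ((b - i) / 2)) else 0) /
        (i.factorial : ℝ) * ((x - h * m) / (h * √D)) ^ i) : ℝ) : ℂ)
      = gaussCoeff (-((h ^ 2 * D / 4 : ℝ) : ℂ)) (b - i) *
        (gridNode h x m ^ i / (i.factorial : ℂ)) := by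
  have hs : √D ≠ 0 := (Real.sqrt_pos.2 hD).ne'
  have hsq : √D ^ 2 = D := Real.sq_sqrt hD.le
  obtain ⟨c, rfl⟩ := Nat.exists_eq_add_of_le hi
  rw [Nat.add_sub_cancel_left]
  by_cases hc : Even c
  · obtain ⟨k, rfl⟩ := hc
    rw [gaussCoeff, if_pos ⟨k, rfl⟩, if_pos ⟨k, rfl⟩, ← two_mul, Nat.mul_div_cancel_left k two_pos,
      gridNode, ← Complex.ofReal_neg]
    rw [← Complex.ofReal_natCast, ← Complex.ofReal_natCast i.factorial]
    norm_cast
    have e1 : (-(h * √D)) ^ i * ((x - h * m) / (h * √D)) ^ i = (h * m - x) ^ i := by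
      rw [← mul_pow]
      congr 1
      field_simp
      ring
    have e2 : (-(h * √D)) ^ (2 * k) = (h ^ 2 * D) ^ k := by
      rw [pow_mul, neg_sq, mul_pow, hsq]
    have e3 : (-(h ^ 2 * D / 4)) ^ k = (-1) ^ k * (h ^ 2 * D) ^ k / 4 ^ k := by
      rw [← mul_pow, ← div_pow]
      congr 1
      ring
    rw [pow_add, e2, e3, ← e1]
    push_cast
    field_simp
  · rw [gaussCoeff, if_neg hc, if_neg hc]
    simp

/-- The lattice sum in the saturation error attached to `β` is the moment of order `β` of the dual
measure. -/
theorem saturation_bracket (hh : 0 < h) (hD : 0 < D) (x : EuclideanSpace ℝ (Fin n))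
    (β : Fin n → ℕ) :
    (((Real.pi * D) ^ (-(n : ℝ) / 2) : ℝ) : ℂ) * ((((-(h * √D)) ^ multiOrder β : ℝ) : ℂ) *
      ((∑' m : Fin n → ℤ, gaussianWeight h D x m *
          ∑ α ∈ Finset.Iic β, coeffA (β - α) / (multiFactorial α : ℝ) *
            monomial (fun j => (x j - h * (m j : ℝ)) / (h * √D)) α : ℝ) : ℂ))
      = ∏ j, moment (dualNode h D) (dualMass h D (x j)) (β j) := by
  let f : Fin n → ℤ → ℂ := fun j m => ∑ i ∈ Finset.Iic (β j),
    gaussCoeff (-((h ^ 2 * D / 4 : ℝ) : ℂ)) (β j - i) *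
      (gridNode h (x j) m ^ i / (i.factorial : ℂ) * gridMass h D (x j) m)
  have hsm : ∀ j i, Summable fun m =>
      ‖gridNode h (x j) m ^ i / (i.factorial : ℂ) * gridMass h D (x j) m‖ := fun j i =>
    (gaussianDecay_grid hh (x j)).summable_moment (by positivity) i
  have hterm : ∀ j i, Summable fun m => gaussCoeff (-((h ^ 2 * D / 4 : ℝ) : ℂ)) (β j - i) *
      (gridNode h (x j) m ^ i / (i.factorial : ℂ) * gridMass h D (x j) m) := fun j i =>
    (hsm j i).of_norm.mul_left _
  have h1 : ∀ j, moment (dualNode h D) (dualMass h D (x j)) (β j)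
      = (((Real.pi * D) ^ (-1 / 2 : ℝ) : ℝ) : ℂ) * ∑' m, f j m := by
    intro j
    rw [moment_dual_eq hh hD, Summable.tsum_finsetSum fun i _ => hterm j i, Finset.mul_sum]
    refine Finset.sum_congr rfl fun i _ => ?_
    rw [tsum_mul_left, moment]
    ring
  have h2 := (hasSum_prod_pi f fun j => (summable_sum fun i _ => hterm j i).norm).2
  simp only [h1, Finset.prod_mul_distrib, ← h2.tsum_eq, rpow_neg_half_eq_prod hD]
  congr 1
  rw [Complex.ofReal_tsum, ← tsum_mul_left]
  congr 1
  ext m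
  rw [Complex.ofReal_mul, gaussianWeight_eq_prod, prod_sum_Iic, mul_left_comm,
    ← Complex.ofReal_mul, Finset.mul_sum, Complex.ofReal_sum, Finset.mul_sum]
  refine Finset.sum_congr rfl fun α hα => ?_
  simp only [← mul_assoc, Finset.prod_mul_distrib]
  rw [mul_comm]
  congr 1
  rw [← Finset.prod_mul_distrib]
  have hα' : ∀ j, α j ≤ β j := Finset.mem_Iic.1 hα
  rw [← Finset.prod_congr rfl fun j _ => scaled_coeff_eq hh hD (x j) (m j) (hα' j),
    ← Complex.ofReal_prod, coeffA_eq_prod, multiOrder, multiFactorial, monomial,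
    ← Finset.prod_pow_eq_pow_sum, Finset.prod_mul_distrib, Finset.prod_mul_distrib,
    Finset.prod_div_distrib]
  push_cast
  rw [mul_assoc]
  rfl

end Assembly

/-! ### The quasi-interpolant and its error -/

section Main

variable {n : ℕ} {h D : ℝ}

theorem sqrtFactorialSummable_multiDeriv {u : EuclideanSpace ℝ (Fin n) → ℂ}
    {x : EuclideanSpace ℝ (Fin n)}
    (hconv : ∀ y : Fin n → ℝ, Summable fun β : Fin n → ℕ =>
      ‖multiDeriv β u x / ((√(multiFactorial β : ℝ) : ℝ) : ℂ) * (monomial y β : ℂ)‖) :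
    SqrtFactorialSummable fun β => multiDeriv β u x := by
  intro Y hY
  convert! hconv fun _ => Y using 2 with β
  rw [norm_mul, norm_div, Complex.norm_real, Complex.norm_real, Real.norm_of_nonneg (by positivity),
    multiFactorial, Nat.cast_prod, Real.sqrt_prod _ fun _ _ => by positivity, monomial,
    Real.norm_of_nonneg (by positivity), Finset.prod_div_distrib]
  ring

theorem isAnalyticExtension_multiSeries {u : EuclideanSpace ℝ (Fin n) → ℂ}
    (hu : HarmonicOnNhd u univ) {x : EuclideanSpace ℝ (Fin n)}
    (hd : SqrtFactorialSummable fun β => multiDeriv β u x) :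
    IsAnalyticExtension u fun z =>
      multiSeries (fun β => multiDeriv β u x / (multiFactorial β : ℂ)) fun j => z j - x j := by
  refine ⟨?_, fun y => (eq_multiSeries_of_harmonic hu x hd.summable_pow y).symm⟩
  refine (analyticOnNhd_multiSeries hd.summable_pow).comp (t := univ) ?_ fun _ _ => mem_univ _
  refine AnalyticOnNhd.pi fun j z _ => ?_
  exact ((ContinuousLinearMap.proj (R := ℂ) j).analyticAt z).sub analyticAt_const

theorem IsAnalyticExtension.unique {u : EuclideanSpace ℝ (Fin n) → ℂ} {v₁ v₂ : (Fin n → ℂ) → ℂ}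
    (h₁ : IsAnalyticExtension u v₁) (h₂ : IsAnalyticExtension u v₂) : v₁ = v₂ :=
  eq_of_eq_on_real h₁.1 h₂.1 fun y => by
    have e₁ := h₁.2 (WithLp.toLp 2 y)
    have e₂ := h₂.2 (WithLp.toLp 2 y)
    exact e₁.trans e₂.symm

theorem mul_gaussianWeight_eq {u : EuclideanSpace ℝ (Fin n) → ℂ}
    (hu : HarmonicOnNhd u univ) {x : EuclideanSpace ℝ (Fin n)}
    (hd : SqrtFactorialSummable fun β => multiDeriv β u x) (m : Fin n → ℤ) :
    u (gridPoint h m) * (gaussianWeight h D x m : ℂ)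
      = multiSeries (fun β => multiDeriv β u x / (multiFactorial β : ℂ))
          (fun j => gridNode h (x j) (m j)) * ∏ j, gridMass h D (x j) (m j) := by
  rw [gaussianWeight_eq_prod, eq_multiSeries_of_harmonic hu x hd.summable_pow]
  congr 2
  ext j
  simp [gridPoint, gridNode]

/-- The quasi-interpolant as a series over the order of the multi-indices, with the moments of the
dual measure. -/
theorem hasSum_quasiInterpolant {u : EuclideanSpace ℝ (Fin n) → ℂ}
    (hu : HarmonicOnNhd u univ) {x : EuclideanSpace ℝ (Fin n)}
    (hd : SqrtFactorialSummable fun β => multiDeriv β u x) (hh : 0 < h) (hD : 0 < D) :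
    HasSum (fun k => ∑ β ∈ Finset.piAntidiag Finset.univ k,
      multiDeriv β u x * ∏ j, moment (dualNode h D) (dualMass h D (x j)) (β j))
      (quasiInterpolant h D u x) := by
  have h1 := (hasSum_multiSeries_moment hd (A := 1 / (h ^ 2 * D)) (by positivity)
    (q := fun j => gridNode h (x j)) (g := fun j => gridMass h D (x j))
    fun j => gaussianDecay_grid hh (x j)).mul_left (((Real.pi * D) ^ (-(n : ℝ) / 2) : ℝ) : ℂ)
  simp only [← mul_gaussianWeight_eq hu hd] at h1
  convert! hasSum_piAntidiag h1 using 2 with k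
  rw [← sum_mul_convolution_gaussCoeff (fun β => sum_multiDeriv_add_two_single hu β x)
    ((h ^ 2 * D / 4 : ℝ) : ℂ)]
  refine Finset.sum_congr rfl fun β _ => ?_
  rw [rpow_neg_half_eq_prod hD, mul_left_comm, ← Finset.prod_mul_distrib]
  simp only [moment_grid_eq hh hD]
  rw [prod_sum_Iic]
  simp only [Finset.prod_mul_distrib]

/-- The saturation error is a partial sum of the series for the quasi-interpolant, minus `u x`. -/
theorem saturationError_eq (u : EuclideanSpace ℝ (Fin n) → ℂ) (x : EuclideanSpace ℝ (Fin n))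
    (hh : 0 < h) (hD : 0 < D) {N : ℕ} (hN : 0 < N) :
    saturationError h D u N x = ∑ k ∈ Finset.range N, ∑ β ∈ Finset.piAntidiag Finset.univ k,
      multiDeriv β u x * ∏ j, moment (dualNode h D) (dualMass h D (x j)) (β j) - u x := by
  have h0 : (((Real.pi * D) ^ (-(n : ℝ) / 2) : ℝ) : ℂ) *
      ((∑' m : Fin n → ℤ, gaussianWeight h D x m : ℝ) : ℂ)
      = ∏ j, moment (dualNode h D) (dualMass h D (x j)) ((0 : Fin n → ℕ) j) := by
    have := saturation_bracket hh hD x (0 : Fin n → ℕ)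
    have hI : Finset.Iic (0 : Fin n → ℕ) = {0} := by
      ext α
      simp
    simpa [hI, multiOrder, coeffA, multiFactorial, monomial] using this
  rw [Finset.range_eq_Ico, Finset.sum_eq_sum_Ico_succ_bot hN, saturationError]
  rw [Finset.piAntidiag_zero, Finset.sum_singleton, multiDeriv_zero, ← h0]
  simp only [← saturation_bracket hh hD x, Finset.mul_sum]
  push_cast
  have : ∀ a b c s : ℂ, a * (b * c - 1) + s = a * (b * c) + s - a := fun a b c s => by ring
  rw [this]
  congr 2
  exact Finset.sum_congr rfl fun k _ => Finset.sum_congr rfl fun β _ => by ring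

theorem prod_dualMass (x : Fin n → ℝ) (m : Fin n → ℤ) :
    ∏ j, dualMass h D (x j) (m j) = Complex.exp (-(Real.pi : ℂ) ^ 2 * D * ∑ j, (m j : ℂ) ^ 2) *
      Complex.exp (2 * Real.pi * Complex.I * (∑ j, (m j : ℂ) * (x j : ℂ)) / h) := by
  simp only [dualMass]
  rw [Finset.prod_mul_distrib, ← Complex.exp_sum, ← Complex.exp_sum, ← Finset.mul_sum,
    ← Finset.sum_div, ← Finset.mul_sum]

theorem multiSeries_zero (c : (Fin n → ℕ) → ℂ) : multiSeries c 0 = c 0 := by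
  rw [multiSeries, tsum_eq_single 0]
  · simp
  · intro β hβ
    obtain ⟨j, hj⟩ := Function.ne_iff.1 hβ
    rw [Finset.prod_eq_zero (Finset.mem_univ j), mul_zero]
    exact zero_pow hj

/-- The dual series over all of `ℤ ^ n` sums to the quasi-interpolant. -/
theorem hasSum_dual {u : EuclideanSpace ℝ (Fin n) → ℂ}
    (hu : HarmonicOnNhd u univ) {x : EuclideanSpace ℝ (Fin n)}
    (hd : SqrtFactorialSummable fun β => multiDeriv β u x) (hh : 0 < h) (hD : 0 < D) :
    HasSum (fun m : Fin n → ℤ => multiSeries (fun β => multiDeriv β u x / (multiFactorial β : ℂ))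
        (fun j => dualNode h D (m j)) * ∏ j, dualMass h D (x j) (m j))
      (quasiInterpolant h D u x) := by
  have hA : 0 < 1 / (h ^ 2 * D) := by positivity
  have hq := fun j : Fin n => gaussianDecay_dual hh hD (x j)
  have h1 := hasSum_multiSeries_moment hd hA (q := fun _ => dualNode h D) hq
  rw [(hasSum_quasiInterpolant hu hd hh hD).unique (hasSum_piAntidiag h1)]
  exact (summable_norm_multiSeries hd hA hq).of_norm.hasSum

end Main

end QuasiInterp

open QuasiInterp Filter in
theorem theorem5p1 (n : ℕ) (u : EuclideanSpace ℝ (Fin n) → ℂ)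
    (hu : InnerProductSpace.HarmonicOnNhd u Set.univ)
    (x : EuclideanSpace ℝ (Fin n))
    (hconv : ∀ y : Fin n → ℝ, Summable fun β : Fin n → ℕ =>
      ‖QuasiInterp.multiDeriv β u x / ((√(QuasiInterp.multiFactorial β : ℝ) : ℝ) : ℂ) *
        (QuasiInterp.monomial y β : ℂ)‖)
    (h D : ℝ) (hh : 0 < h) (hD : 0 < D) (hhD : √D * h < 1) :
    (∃! v : (Fin n → ℂ) → ℂ, QuasiInterp.IsAnalyticExtension u v) ∧
    (Summable fun m : Fin n → ℤ =>
      ‖u (QuasiInterp.gridPoint h m) * (QuasiInterp.gaussianWeight h D x m : ℂ)‖) ∧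
    Filter.Tendsto (fun M : ℕ => QuasiInterp.saturationError h D u (2 * M) x) Filter.atTop
      (nhds (QuasiInterp.quasiInterpolant h D u x - u x)) ∧
    ∀ v : (Fin n → ℂ) → ℂ, QuasiInterp.IsAnalyticExtension u v →
      HasSum (fun m : {m : Fin n → ℤ // m ≠ 0} =>
        v (fun j => (x j : ℂ) + Real.pi * Complex.I * h * D * (m.1 j : ℂ)) *
          Complex.exp (-(Real.pi : ℂ) ^ 2 * D * ∑ j, (m.1 j : ℂ) ^ 2) *
          Complex.exp (2 * Real.pi * Complex.I * (∑ j, (m.1 j : ℂ) * (x j : ℂ)) / h))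
        (QuasiInterp.quasiInterpolant h D u x - u x) := by
  have hd := sqrtFactorialSummable_multiDeriv hconv
  have hext := isAnalyticExtension_multiSeries hu hd
  refine ⟨⟨_, hext, fun v hv => hv.unique hext⟩, ?_, ?_, fun v hv => ?_⟩
  · simp only [mul_gaussianWeight_eq hu hd]
    exact summable_norm_multiSeries hd (A := 1 / (h ^ 2 * D)) (by positivity)
      fun j => gaussianDecay_grid hh (x j)
  · have h1 := (hasSum_quasiInterpolant hu hd hh hD).tendsto_sum_nat.comp
      (tendsto_id.const_mul_atTop' (show 0 < 2 by norm_num))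
    refine (h1.sub_const (u x)).congr' ?_
    filter_upwards [eventually_gt_atTop 0] with M hM
    exact (saturationError_eq u x hh hD (N := 2 * M) (by omega)).symm
  · obtain rfl := hv.unique hext
    have h1 := hasSum_dual hu hd hh hD
    have h2 := h1.sub (hasSum_pi_single (0 : Fin n → ℤ) (u x))
    rw [← (Subtype.val_injective (p := fun m : Fin n → ℤ => m ≠ 0)).hasSum_iff] at h2
    · convert! h2 using 2 with m
      simp only [Function.comp_apply, Pi.single_eq_of_ne m.2, sub_zero, prod_dualMass, dualNode,
        add_sub_cancel_left, mul_assoc]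
    · intro m hm
      -- the term `m = 0` of the dual series is the value of the Taylor series at its centre
      obtain rfl : m = 0 := by simpa using hm
      have h3 : (fun _ : Fin n => dualNode h D 0) = 0 := by
        ext j
        simp [dualNode]
      simp [h3, multiSeries_zero, multiDeriv_zero, multiFactorial, dualMass]
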